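/- Let $\mathbb K$ be a commutative ring, $\mathsf{Mod}(\mathbb K)$ the category of $\mathbb K$-modules, and $\Phi:\mathsf{Mod}(\mathbb K)\to\mathsf{Mod}(\mathbb K)$ a functor (not necessarily additive). **Notation.** For a $\mathbb K$-module $A$ let $\mathsf{Pres}(A)$ be the full subcategory of the comma category $\mathsf{Mod}(\mathbb K)\downarrow A$ whose objects are the epimorphisms $p:F\twoheadrightarrow A$ with $F$ free, and let $\mathsf R_A:\mathsf{Pres}(A)\to\mathsf{Mod}(\mathbb K)$, $\mathsf R_A(p)=\mathsf{Ker}(p)$. For a functor $\mathcal F:\mathsf{Pres}(A)\to\mathsf{Mod}(\mathbb K)$ let $\mathsf{lim}^i\mathcal F$ be its $i$-th derived limit (the $i$-th right derived functor of $\mathsf{lim}$, applied to $\mathcal F$). For an object $p$ of $\mathsf{Pres}(A)$ let $p^\bullet$ be the cosimplicial object with $(p^\bullet)^n=p^{\sqcup(n+1)}=(F^{\oplus (n+1)}\to A)$, in which a monotone map $\theta:[m]\to[n]$ sends the $i$-th summand identically to the $\theta(i)$-th one; let $\mathsf{Lim}_{(p)}\mathcal F=N^\bullet(\mathcal F(p^\bullet))$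 be the normalised cochain complex, with components $\bigcap_i\mathsf{Ker}(s^i)$ (the whole module in degree $0$) and differential $\sum_i(-1)^id^i$. The cross effect $\Phi(A_1|\dots|A_n)$ is the kernel of the map $\Phi(\bigoplus_i A_i)\to\bigoplus_j\Phi(\bigoplus_{i\ne j}A_i)$ induced by the canonical projections; it is a direct summand of $\Phi(\bigoplus_iA_i)$, by the projection that vanishes on the images of the maps $\Phi(\bigoplus_{i\neq j}A_i)\to\Phi(\bigoplus_iA_i)$ induced by the embeddings. The functor $\Phi$ is polynomial of degree $\le d$ if $\Phi(A_1|\dots|A_{d+1})=0$ for all $A_1,\dots,A_{d+1}$. Let $C_\Phi(A)$ be the cochain complex with $C_\Phi(A)^n=\Phi(A|\dots|A)$ ($n+1$ entries), $n\ge 0$, and differential $\sum_{i=0}^n(-1)^ih^i$, where $h^i$ is the composition of the inclusion $C_\Phi(A)^n\rightarrowtail\Phi(A^{\oplus (n+1)})$, the map $\Phi(\Delta^i)$ with $\Delta^i(a_0,\dots,a_n)=(a_0,\dots,a_i,a_i,\dots,a_n)$, and the projection $\Phi(A^{\oplus (n+2)})\twoheadrightarrow C_\Phi(A)^{n+1}$.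 **Statement.** 1. For functors $\Phi$ with $\Phi(0)=0$ and free $\mathbb K$-modules $A$ there is an isomorphism of cochain complexes $$\mathsf{Lim}_{(\mathsf{id}_A)}\,\Phi\mathsf R_A\;\cong\;C_\Phi(A)[-1],$$ natural in $\Phi$ and in $A$. Here both complexes are extended by zero to negative degrees, and $C[-1]^n=C^{n-1}$ with differential $-\partial_C$. 2. If $\Phi$ is polynomial of degree $\le d$, where $d\ge 0$ (in particular, if it is polynomial of degree $d$), then for every $\mathbb K$-module $A$, free or not, $$\mathsf{lim}^i\,\Phi\mathsf R_A=0\qquad\text{for all } i>d.$$ -/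

import Mathlib

open CategoryTheory Limits

universe u v w w'

noncomputable section

namespace RelLim

/-! ### Derived limits -/

section DerivedLimits

lemma enoughInjectives_functor_discrete (C : Type w) (D : Type w') [Category.{v} D]
    [HasPullbacks D] [EnoughInjectives D] : EnoughInjectives (Discrete C ⥤ D) where
  presentation F := ⟨{
    J := Discrete.functor fun c => Injective.under (F.obj ⟨c⟩)
    injective := ⟨fun {X Y} g f _ => ⟨Discrete.natTrans fun c =>
      Injective.factorThru (J := Injective.under (F.obj ⟨c.as⟩)) (g.app c) (f.app c), by
        ext1; funext c
        exact Injective.comp_factorThru (J := Injective.under (F.obj ⟨c.as⟩))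
          (g.app c) (f.app c)⟩⟩
    f := Discrete.natTrans fun c => Injective.ι (F.obj c)
    mono := by
      rw [NatTrans.mono_iff_mono_app]
      intro c
      exact inferInstanceAs (Mono (Injective.ι (F.obj c))) }⟩

lemma enoughInjectives_functor (C : Type w) [Category.{u} C] (D : Type w') [Category.{v} D]
    [HasPullbacks D] [EnoughInjectives D]
    [∀ X : C, HasLimitsOfShape (StructuredArrow X (Discrete.functor (id : C → C))) D] :
    EnoughInjectives (C ⥤ D) := by
  let L : Discrete C ⥤ C := Discrete.functor id
  have (G : Discrete C ⥤ D) : L.HasPointwiseRightKanExtension G :=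
    fun X => inferInstanceAs (HasLimit (StructuredArrow.proj X L ⋙ G))
  have : ((Functor.whiskeringLeft (Discrete C) C D).obj L).ReflectsMonomorphisms :=
    ⟨fun {F G} f hf => by
      rw [NatTrans.mono_iff_mono_app] at hf ⊢
      exact fun c => hf ⟨c⟩⟩
  have : ((Functor.whiskeringLeft (Discrete C) C D).obj L).PreservesMonomorphisms :=
    ⟨fun {F G} f hf => by
      rw [NatTrans.mono_iff_mono_app] at hf ⊢
      exact fun c => hf (L.obj c)⟩
  have := enoughInjectives_functor_discrete C D
  exact EnoughInjectives.of_adjunction (L.ranAdjunction D)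

variable (K : Type u) [CommRing K] (C : Type (u + 1)) [Category.{u} C]

instance hasLimitsOfShape_moduleCat : HasLimitsOfShape C (ModuleCat.{u + 1} K) :=
  ModuleCat.hasLimitsOfShape.{u, u + 1, u + 1, u}

instance enoughInjectives_functor_moduleCat : EnoughInjectives (C ⥤ ModuleCat.{u + 1} K) := by
  have (X : C) : HasLimitsOfShape (StructuredArrow X (Discrete.functor (id : C → C)))
      (ModuleCat.{u + 1} K) := by
    let g : StructuredArrow X (Discrete.functor (id : C → C)) →
      Σ c : Discrete C, (X ⟶ (Discrete.functor (id : C → C)).obj c) := fun s => ⟨s.right, s.hom⟩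
    have hg : Function.Injective g := by
      rintro ⟨⟨⟩, c, s⟩ ⟨⟨⟩, c', s'⟩ h
      simp only [g, Sigma.mk.injEq] at h
      obtain ⟨rfl, h⟩ := h
      cases h
      rfl
    have := small_of_injective.{u + 1} hg
    exact ModuleCat.hasLimitsOfShape
  have : HasPullbacks (ModuleCat.{u + 1} K) := Abelian.hasPullbacks
  exact enoughInjectives_functor C (ModuleCat.{u + 1} K)

instance lim_additive :
    (lim : (C ⥤ ModuleCat.{u + 1} K) ⥤ ModuleCat.{u + 1} K).Additive where
  map_add {F G f g} := limit.hom_ext fun c => by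
    rw [Preadditive.add_comp]
    simp only [lim_map, limMap_π, NatTrans.app_add, Preadditive.comp_add]

variable {K C}

/-- The `i`-th derived limit `limⁱ F`: the `i`-th right derived functor of
`lim : (C ⥤ Mod K) ⥤ Mod K`. Since the category `C` is as large as `ModuleCat.{u} K`, the limit
and its derived functors are formed in modules in the next universe. -/
def higherLim (F : C ⥤ ModuleCat.{u} K) (i : ℕ) : ModuleCat.{u + 1} K :=
  ((lim : (C ⥤ ModuleCat.{u + 1} K) ⥤ ModuleCat.{u + 1} K).rightDerived i).obj
    (F ⋙ ModuleCat.uliftFunctor.{u + 1, u} K)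

end DerivedLimits

/-! ### The normalised cochain complex of a cosimplicial module -/

section Normalized

variable {K : Type u} [CommRing K]

/-- `Nⁿ V = ⋂ Ker (sⁱ : Vⁿ → Vⁿ⁻¹)`. -/
def normalizedSubmodule (V : CosimplicialObject (ModuleCat.{u} K)) :
    (n : ℕ) → Submodule K (V.obj (SimplexCategory.mk n))
  | 0 => ⊤
  | n + 1 => ⨅ i : Fin (n + 1), LinearMap.ker (V.σ i).hom

/-- The alternating sum of the cofaces `∑ (-1)ⁱ dⁱ : Vⁿ → Vⁿ⁺¹`. -/
def alternatingCoface (V : CosimplicialObject (ModuleCat.{u} K)) (n : ℕ) :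
    V.obj (SimplexCategory.mk n) →ₗ[K] V.obj (SimplexCategory.mk (n + 1)) :=
  (∑ i : Fin (n + 2), (-1 : ℤ) ^ (i : ℕ) • V.δ i).hom

lemma alternatingCoface_apply (V : CosimplicialObject (ModuleCat.{u} K)) (n : ℕ)
    (x : V.obj (SimplexCategory.mk n)) :
    alternatingCoface V n x = ∑ i : Fin (n + 2), (-1 : ℤ) ^ (i : ℕ) • (V.δ i).hom x := by
  simp [alternatingCoface, ModuleCat.hom_sum]

lemma sigma_delta_eq_zero (V : CosimplicialObject (ModuleCat.{u} K)) (n : ℕ)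
    (x : V.obj (SimplexCategory.mk n)) (hx : x ∈ normalizedSubmodule V n) (j : Fin (n + 1))
    (i : Fin (n + 2)) (h₁ : i ≠ j.castSucc) (h₂ : i ≠ j.succ) :
    (V.σ j).hom ((V.δ i).hom x) = 0 := by
  obtain _ | n := n
  · fin_cases j
    fin_cases i <;> simp_all
  · have hx' : ∀ k, (V.σ k).hom x = 0 := by
      simpa [normalizedSubmodule, Submodule.mem_iInf] using hx
    rw [← LinearMap.comp_apply, ← ModuleCat.hom_comp]
    rcases lt_trichotomy i j.castSucc with h | h | h
    · obtain ⟨j, rfl⟩ := Fin.exists_succ_eq_of_ne_zero (x := j) (by rintro rfl; simp at h)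
      obtain ⟨i, rfl⟩ := Fin.exists_castSucc_eq.2 (show i ≠ Fin.last _ by
        rintro rfl; exact absurd h (not_lt.2 (Fin.le_last _)))
      rw [V.δ_comp_σ_of_le (by rw [← Fin.succ_castSucc, Fin.castSucc_lt_succ_iff] at h; exact h),
        ModuleCat.hom_comp, LinearMap.comp_apply, hx', map_zero]
    · exact absurd h h₁
    · have h' : j.succ < i := lt_of_le_of_ne (Fin.castSucc_lt_iff_succ_le.1 h) (Ne.symm h₂)
      obtain ⟨i, rfl⟩ := Fin.exists_succ_eq_of_ne_zero (x := i) (by rintro rfl; simp at h)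
      rw [Fin.succ_lt_succ_iff] at h'
      obtain ⟨j, rfl⟩ := Fin.exists_castSucc_eq.2 (show j ≠ Fin.last _ by
        rintro rfl; exact absurd h' (not_lt.2 (Fin.le_last _)))
      rw [V.δ_comp_σ_of_gt h', ModuleCat.hom_comp, LinearMap.comp_apply, hx', map_zero]

lemma alternatingCoface_mem (V : CosimplicialObject (ModuleCat.{u} K)) (n : ℕ) :
    ∀ x ∈ normalizedSubmodule V n, alternatingCoface V n x ∈ normalizedSubmodule V (n + 1) := by
  intro x hx
  simp only [normalizedSubmodule, Submodule.mem_iInf, LinearMap.mem_ker]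
  intro j
  rw [alternatingCoface_apply, map_sum,
    Finset.sum_eq_add (a := j.castSucc) (b := j.succ) (Fin.castSucc_lt_succ).ne]
  · have h1 := congr($(V.δ_comp_σ_self (i := j)).hom x)
    have h2 := congr($(V.δ_comp_σ_succ (i := j)).hom x)
    simp only [ModuleCat.hom_comp, LinearMap.comp_apply, ModuleCat.hom_id,
      LinearMap.id_apply] at h1 h2
    rw [map_zsmul, map_zsmul, h1, h2, ← add_smul]
    simp [pow_succ]
  · rintro i - ⟨h₁, h₂⟩
    rw [map_zsmul, sigma_delta_eq_zero V n x hx j i h₁ h₂, smul_zero]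
  · simp
  · simp

/-- The normalised cochain complex `N V`. -/
def normalizedComplex (V : CosimplicialObject (ModuleCat.{u} K)) :
    CochainComplex (ModuleCat.{u} K) ℕ :=
  CochainComplex.of (fun n => ModuleCat.of K (normalizedSubmodule V n))
    (fun n => ModuleCat.ofHom ((alternatingCoface V n).restrict (alternatingCoface_mem V n)))
    (fun n => by
      ext x
      exact congr($(AlgebraicTopology.AlternatingCofaceMapComplex.d_squared V n).hom x.1))

lemma normalizedMap_mem {V W : CosimplicialObject (ModuleCat.{u} K)} (f : V ⟶ W) (n : ℕ) :
    ∀ x ∈ normalizedSubmodule V n,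
      (f.app (SimplexCategory.mk n)).hom x ∈ normalizedSubmodule W n := by
  intro x hx
  obtain _ | n := n
  · trivial
  · simp only [normalizedSubmodule, Submodule.mem_iInf, LinearMap.mem_ker] at hx ⊢
    intro i
    have h := congr($(f.naturality (SimplexCategory.σ i)).hom x)
    simp only [ModuleCat.hom_comp, LinearMap.comp_apply] at h
    refine h.symm.trans ?_
    erw [hx i]
    rw [map_zero]

/-- The morphism `N V ⟶ N W` induced by a morphism of cosimplicial modules. -/
def normalizedMap {V W : CosimplicialObject (ModuleCat.{u} K)} (f : V ⟶ W) :
    normalizedComplex V ⟶ normalizedComplex W :=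
  CochainComplex.ofHom
    (fun n => ModuleCat.ofHom
      ((f.app (SimplexCategory.mk n)).hom.restrict (normalizedMap_mem f n)))
    (fun n => by
      simp only [normalizedComplex, CochainComplex.of_d]
      ext x
      have h := congr($((AlgebraicTopology.AlternatingCofaceMapComplex.map f).comm n (n + 1)).hom
        x.1)
      simp only [AlgebraicTopology.AlternatingCofaceMapComplex.obj, CochainComplex.of_d] at h
      exact h)

end Normalized

/-! ### The standard complex for higher limits -/

section StandardComplex

variable {K : Type u} [CommRing K] {C : Type w} [Category.{v} C]

/-- The cosimplicial object `c^•` with `(c^•)ⁿ = c ⊔ ⋯ ⊔ c` (`n + 1` summands), for given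
coproducts of copies of `c`. A map `θ : [m] → [n]` induces the morphism that sends the `i`-th
summand identically to the `θ i`-th one. -/
def copowers (c : C) (cof : ∀ n : ℕ, Cofan fun _ : Fin (n + 1) => c)
    (hc : ∀ n, IsColimit (cof n)) : CosimplicialObject C where
  obj n := (cof n.len).pt
  map {m n} θ := Cofan.IsColimit.desc (hc m.len) fun i => (cof n.len).inj (θ.toOrderHom i)
  map_id n := Cofan.IsColimit.hom_ext (hc _) _ _ fun i => by simp
  map_comp f g := Cofan.IsColimit.hom_ext (hc _) _ _ fun i => by simp

/-- The standard complex `Lim_(c) F = N (F (c^•))` of a functor `F` at an object `c`. -/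
def standardComplex (F : C ⥤ ModuleCat.{u} K) (c : C)
    (cof : ∀ n : ℕ, Cofan fun _ : Fin (n + 1) => c) (hc : ∀ n, IsColimit (cof n)) :
    CochainComplex (ModuleCat.{u} K) ℕ :=
  normalizedComplex (copowers c cof hc ⋙ F)

end StandardComplex

/-! ### Presentations and the relation functor -/

section Presentations

variable {K : Type u} [CommRing K]

/-- The objects `F → A` of the comma category that are surjective with `F` free. -/
def isPresentation (A : ModuleCat.{u} K) : ObjectProperty (Over A) := fun p =>
  Function.Surjective p.hom.hom ∧ Module.Free K p.left

/-- The category of presentations of `A`, a full subcategory of `Mod K ↓ A`. -/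
abbrev Pres (A : ModuleCat.{u} K) : Type (u + 1) := (isPresentation A).FullSubcategory

/-- The relation functor `R_A`, with `R_A (p) = Ker p`. -/
def relationFunctor (A : ModuleCat.{u} K) : Pres A ⥤ ModuleCat.{u} K where
  obj p := ModuleCat.of K (LinearMap.ker p.obj.hom.hom)
  map {p q} f := ModuleCat.ofHom (f.hom.left.hom.restrict fun x hx => by
    have h := congr($(Over.w f.hom).hom x)
    simp only [ModuleCat.hom_comp, LinearMap.comp_apply] at h
    rw [LinearMap.mem_ker] at hx ⊢
    rw [h, hx])

/-- The map `(a₀, …, aₙ) ↦ ∑ⱼ gⱼ(aⱼ)`. -/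
def sumMap {M N : Type u} [AddCommGroup M] [Module K M] [AddCommGroup N] [Module K N] {n : ℕ}
    (g : Fin n → (M →ₗ[K] N)) : (Fin n → M) →ₗ[K] N :=
  ∑ j, g j ∘ₗ LinearMap.proj j

lemma sumMap_apply {M N : Type u} [AddCommGroup M] [Module K M] [AddCommGroup N] [Module K N]
    {n : ℕ} (g : Fin n → (M →ₗ[K] N)) (a : Fin n → M) : sumMap g a = ∑ j, g j (a j) := by
  simp [sumMap]

lemma sumMap_single {M N : Type u} [AddCommGroup M] [Module K M] [AddCommGroup N] [Module K N]
    {n : ℕ} (g : Fin n → (M →ₗ[K] N)) (i : Fin n) (x : M) :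
    sumMap g (Pi.single i x) = g i x := by
  rw [sumMap_apply, Finset.sum_eq_single i (fun j _ h => by simp [h]) (by simp)]
  simp

lemma sumMap_map {M N : Type u} [AddCommGroup M] [Module K M] [AddCommGroup N] [Module K N]
    {m n : ℕ} (g : M →ₗ[K] N) (θ : Fin m → Fin n) (a : Fin m → M) (k : Fin n) :
    g (sumMap (fun i => LinearMap.single K (fun _ : Fin n => M) (θ i)) a k) =
      sumMap (fun i => LinearMap.single K (fun _ : Fin n => N) (θ i)) (fun j => g (a j)) k := by
  rw [sumMap_apply, sumMap_apply]
  simp [Finset.sum_apply, Pi.single_apply, apply_ite]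

/-- The presentation `p ⊔ ⋯ ⊔ p : F ⊕ ⋯ ⊕ F → A` with `n + 1` summands. -/
def copower {A : ModuleCat.{u} K} (p : Pres A) (n : ℕ) : Pres A where
  obj := Over.mk (Y := ModuleCat.of K (Fin (n + 1) → p.obj.left))
    (ModuleCat.ofHom (sumMap fun _ => p.obj.hom.hom))
  property := ⟨fun a => by
    obtain ⟨x, hx⟩ := p.property.1 a
    exact ⟨Pi.single 0 x, (sumMap_single _ _ _).trans hx⟩, by
    have := p.property.2
    exact inferInstanceAs (Module.Free K (Fin (n + 1) → p.obj.left))⟩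

/-- The cofan of the inclusions of the summands of `p ⊔ ⋯ ⊔ p`. -/
def copowerCofan {A : ModuleCat.{u} K} (p : Pres A) (n : ℕ) : Cofan fun _ : Fin (n + 1) => p :=
  Cofan.mk (copower p n) fun i => ObjectProperty.homMk
    (Over.homMk (ModuleCat.ofHom (LinearMap.single K (fun _ : Fin (n + 1) => p.obj.left) i)) (by
      ext x
      exact sumMap_single _ _ _))

/-- `p ⊔ ⋯ ⊔ p` is a coproduct in the category of presentations. -/
def copowerCofanIsColimit {A : ModuleCat.{u} K} (p : Pres A) (n : ℕ) :
    IsColimit (copowerCofan p n) :=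
  Cofan.IsColimit.mk _
    (fun t => ObjectProperty.homMk (Over.homMk
      (ModuleCat.ofHom (sumMap fun j => (t.inj j).hom.left.hom)) (by
        ext x
        have h (j : Fin (n + 1)) := congr($(Over.w (t.inj j).hom).hom (x j))
        simp only [ModuleCat.hom_comp, LinearMap.comp_apply] at h
        refine (congrArg t.pt.obj.hom.hom (sumMap_apply _ _)).trans
          (Eq.trans ?_ (sumMap_apply _ _).symm)
        rw [map_sum]
        exact Finset.sum_congr rfl fun j _ => h j)))
    (fun t j => by
      apply ObjectProperty.hom_ext
      ext x
      exact sumMap_single _ _ _)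
    (fun t m hm => by
      apply ObjectProperty.hom_ext
      apply Over.OverMorphism.ext
      apply ModuleCat.hom_ext
      refine LinearMap.pi_ext (φ := fun _ : Fin (n + 1) => p.obj.left) fun j x => ?_
      refine Eq.trans ?_ (sumMap_single _ _ _).symm
      rw [← hm j]
      rfl)

/-- The complex `Lim_(p) ΦR_A` of a presentation `p` of `A`. -/
def LimComplex (Φ : ModuleCat.{u} K ⥤ ModuleCat.{u} K) {A : ModuleCat.{u} K} (p : Pres A) :
    CochainComplex (ModuleCat.{u} K) ℕ :=
  standardComplex (relationFunctor A ⋙ Φ) p (copowerCofan p) (copowerCofanIsColimit p)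

lemma copowers_map_left {A : ModuleCat.{u} K} (p : Pres A) {m n : SimplexCategory} (θ : m ⟶ n) :
    ((copowers p (copowerCofan p) (copowerCofanIsColimit p)).map θ).hom.left =
      ModuleCat.ofHom (sumMap fun i => LinearMap.single K (fun _ : Fin (n.len + 1) => p.obj.left)
        (θ.toOrderHom i)) :=
  rfl

/-- The morphism of cosimplicial modules `R_A (p^•) ⟶ R_B (q^•)` induced by a commutative square
`g ≫ q = p ≫ f`. -/
def relationCopowersMap {A B : ModuleCat.{u} K} (p : Pres A) (q : Pres B) (f : A ⟶ B)
    (g : p.obj.left ⟶ q.obj.left) (w : g ≫ q.obj.hom = p.obj.hom ≫ f) :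
    copowers p (copowerCofan p) (copowerCofanIsColimit p) ⋙ relationFunctor A ⟶
      copowers q (copowerCofan q) (copowerCofanIsColimit q) ⋙ relationFunctor B where
  app n := ModuleCat.ofHom (LinearMap.restrict (p := LinearMap.ker (copower p n.len).obj.hom.hom)
    (q := LinearMap.ker (copower q n.len).obj.hom.hom)
    (LinearMap.pi fun j => g.hom ∘ₗ LinearMap.proj j :
      (Fin (n.len + 1) → p.obj.left) →ₗ[K] (Fin (n.len + 1) → q.obj.left)) (by
      intro a ha
      have h (x : p.obj.left) := congr($(w).hom x)
      simp only [ModuleCat.hom_comp, LinearMap.comp_apply] at h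
      have ha' : ∑ j, p.obj.hom.hom (a j) = 0 := (sumMap_apply _ _).symm.trans ha
      refine (sumMap_apply _ _).trans ?_
      change ∑ j, q.obj.hom.hom (g.hom (a j)) = 0
      simp only [h]
      rw [← map_sum, ha', map_zero]))
  naturality m n θ := by
    ext x
    apply Subtype.ext
    obtain ⟨a, ha⟩ := x
    change (fun k => g.hom (sumMap (fun i => LinearMap.single K
      (fun _ : Fin (n.len + 1) => p.obj.left) (θ.toOrderHom i)) a k)) =
      sumMap (fun i => LinearMap.single K (fun _ : Fin (n.len + 1) => q.obj.left)
        (θ.toOrderHom i)) (fun j => g.hom (a j))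
    funext k
    exact sumMap_map g.hom (fun i => θ.toOrderHom i) a k

/-- The morphism `Lim_(p) ΦR_A ⟶ Lim_(q) ΨR_B` induced by a natural transformation `Φ ⟶ Ψ` and
a commutative square. -/
def LimComplexMap {Φ Ψ : ModuleCat.{u} K ⥤ ModuleCat.{u} K} (α : Φ ⟶ Ψ) {A B : ModuleCat.{u} K}
    (p : Pres A) (q : Pres B) (f : A ⟶ B)
    (g : p.obj.left ⟶ q.obj.left) (w : g ≫ q.obj.hom = p.obj.hom ≫ f) :
    LimComplex Φ p ⟶ LimComplex Ψ q :=
  normalizedMap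
    (Functor.whiskerRight (relationCopowersMap p q f g w) Φ ≫
      Functor.whiskerLeft
        (copowers q (copowerCofan q) (copowerCofanIsColimit q) ⋙ relationFunctor B) α)

/-- The presentation `id : A → A` of a free module `A`. -/
def idPres (A : ModuleCat.{u} K) [Module.Free K A] : Pres A where
  obj := Over.mk (𝟙 A)
  property := ⟨fun a => ⟨a, rfl⟩, inferInstanceAs (Module.Free K A)⟩

end Presentations

/-! ### Cross effects -/

section CrossEffects

variable {K : Type u} [CommRing K]

/-- The canonical projection `⨁ᵢ Aᵢ → ⨁_{i ≠ j} Aᵢ`. -/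
def prHom {n : ℕ} (A : Fin n → ModuleCat.{u} K) (j : Fin n) :
    ModuleCat.of K (∀ i, A i) ⟶ ModuleCat.of K (∀ i : {i // i ≠ j}, A i.1) :=
  ModuleCat.ofHom (LinearMap.pi fun i => LinearMap.proj i.1)

/-- The cross effect `Φ(A₁|⋯|Aₙ)`, the kernel of `Φ(⨁ᵢ Aᵢ) → ⨁ⱼ Φ(⨁_{i ≠ j} Aᵢ)`. -/
def crossEffect (Φ : ModuleCat.{u} K ⥤ ModuleCat.{u} K) {n : ℕ} (A : Fin n → ModuleCat.{u} K) :
    Submodule K (Φ.obj (ModuleCat.of K (∀ i, A i))) :=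
  LinearMap.ker (LinearMap.pi fun j => (Φ.map (prHom A j)).hom)

/-- `Φ` is polynomial of degree `≤ d`: its cross effects of order `d + 1` vanish. -/
def IsPolynomialOfDegreeLE (Φ : ModuleCat.{u} K ⥤ ModuleCat.{u} K) (d : ℕ) : Prop :=
  ∀ A : Fin (d + 1) → ModuleCat.{u} K, crossEffect Φ A = ⊥

/-- The idempotent of `⨁ᵢ Aᵢ` that is the identity on `Aᵢ` for `i ∈ S` and zero on the other
summands. -/
def keep {n : ℕ} (A : Fin n → ModuleCat.{u} K) (S : Finset (Fin n)) :
    ModuleCat.of K (∀ i, A i) ⟶ ModuleCat.of K (∀ i, A i) :=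
  ModuleCat.ofHom (LinearMap.pi fun i => if i ∈ S then LinearMap.proj i else 0)

/-- `∑_S (-1)^{n - |S|} Φ(e_S)` where `e_S` is the idempotent of `S`. -/
def crossEffectIdempotent (Φ : ModuleCat.{u} K ⥤ ModuleCat.{u} K) {n : ℕ}
    (A : Fin n → ModuleCat.{u} K) :
    Φ.obj (ModuleCat.of K (∀ i, A i)) →ₗ[K] Φ.obj (ModuleCat.of K (∀ i, A i)) :=
  ∑ S : Finset (Fin n), (-1 : K) ^ Sᶜ.card • (Φ.map (keep A S)).hom


lemma keep_univ {n : ℕ} (A : Fin n → ModuleCat.{u} K) : keep A Finset.univ = 𝟙 _ := by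
  apply ModuleCat.hom_ext
  refine LinearMap.ext fun a => funext fun i => ?_
  simp [keep]

lemma keep_comp_prHom {n : ℕ} (A : Fin n → ModuleCat.{u} K) (S T : Finset (Fin n)) (j : Fin n)
    (h : ∀ i ≠ j, i ∈ S ↔ i ∈ T) : keep A S ≫ prHom A j = keep A T ≫ prHom A j := by
  apply ModuleCat.hom_ext
  refine LinearMap.ext fun a => funext fun i => ?_
  have := h i.1 i.2
  by_cases hi : i.1 ∈ S <;> simp [keep, prHom, hi, ← this]

lemma signed_sum_eq_zero {M : Type u} [AddCommGroup M] [Module K M] {n : ℕ}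
    (v : Finset (Fin n) → M) (j : Fin n) (h : ∀ S, j ∉ S → v (insert j S) = v S) :
    ∑ S : Finset (Fin n), (-1 : K) ^ Sᶜ.card • v S = 0 := by
  have key : ∀ S : Finset (Fin n), j ∉ S →
      (-1 : K) ^ Sᶜ.card • v S + (-1 : K) ^ (insert j S)ᶜ.card • v (insert j S) = 0 := by
    intro S hS
    have hc : Sᶜ.card = (insert j S)ᶜ.card + 1 := by
      rw [Finset.compl_insert, Finset.card_erase_add_one (by simpa using hS)]
    rw [h S hS, hc, ← add_smul, pow_succ]
    simp
  refine Finset.sum_involution (fun S _ => if j ∈ S then S.erase j else insert j S) ?_ ?_ ?_ ?_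
  · intro S _
    by_cases hS : j ∈ S
    · simp only [hS, if_true]
      have := key (S.erase j) (by simp)
      rw [Finset.insert_erase hS] at this
      rw [add_comm]
      exact this
    · simp only [hS, if_false]
      exact key S hS
  · intro S _ _ hh
    by_cases hS : j ∈ S
    · simp only [hS, if_true] at hh
      rw [← hh] at hS
      simp at hS
    · simp only [hS, if_false] at hh
      rw [← hh] at hS
      simp at hS
  · simp
  · intro S _
    by_cases hS : j ∈ S
    · simp [hS, Finset.insert_erase]
    · simp [hS]

variable (Φ : ModuleCat.{u} K ⥤ ModuleCat.{u} K)

lemma mem_crossEffect {n : ℕ} (A : Fin n → ModuleCat.{u} K)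
    (x : Φ.obj (ModuleCat.of K (∀ i, A i))) :
    x ∈ crossEffect Φ A ↔ ∀ j, (Φ.map (prHom A j)).hom x = 0 := by
  rw [crossEffect, LinearMap.mem_ker]
  exact funext_iff

lemma crossEffectIdempotent_mem {n : ℕ} (A : Fin n → ModuleCat.{u} K)
    (x : Φ.obj (ModuleCat.of K (∀ i, A i))) : crossEffectIdempotent Φ A x ∈ crossEffect Φ A := by
  rw [mem_crossEffect]
  intro j
  simp only [crossEffectIdempotent, LinearMap.sum_apply, LinearMap.smul_apply, map_sum, map_smul]
  refine signed_sum_eq_zero _ j fun S hS => ?_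
  rw [← LinearMap.comp_apply, ← LinearMap.comp_apply, ← ModuleCat.hom_comp, ← ModuleCat.hom_comp,
    ← Φ.map_comp, ← Φ.map_comp, keep_comp_prHom A (insert j S) S j fun i hi => by simp [hi]]

/-- The projection `Φ(⨁ᵢ Aᵢ) → Φ(A₁|⋯|Aₙ)` onto the direct summand: it is the identity on the
cross effect and vanishes on the image of `Φ(⨁_{i ≠ j} Aᵢ)` for every `j`, as shown below. -/
def crossEffectProj {n : ℕ} (A : Fin n → ModuleCat.{u} K) :
    Φ.obj (ModuleCat.of K (∀ i, A i)) →ₗ[K] crossEffect Φ A :=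
  (crossEffectIdempotent Φ A).codRestrict _ (crossEffectIdempotent_mem Φ A)

/-- The canonical embedding `⨁_{i ≠ j} Aᵢ → ⨁ᵢ Aᵢ`. -/
def emHom {n : ℕ} (A : Fin n → ModuleCat.{u} K) (j : Fin n) :
    ModuleCat.of K (∀ i : {i // i ≠ j}, A i.1) ⟶ ModuleCat.of K (∀ i, A i) :=
  ModuleCat.ofHom (LinearMap.pi fun i => if h : i ≠ j then
    LinearMap.proj (φ := fun k : {k // k ≠ j} => A k.1) ⟨i, h⟩ else 0)

lemma prHom_emHom_keep {n : ℕ} (A : Fin n → ModuleCat.{u} K) (S : Finset (Fin n)) (j : Fin n)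
    (hj : j ∉ S) : prHom A j ≫ emHom A j ≫ keep A S = keep A S := by
  apply ModuleCat.hom_ext
  refine LinearMap.ext fun a => funext fun i => ?_
  by_cases hi : i ∈ S
  · have : i ≠ j := by rintro rfl; exact hj hi
    simp [prHom, emHom, keep, hi, this]
  · simp [prHom, emHom, keep, hi]

lemma crossEffectProj_of_mem {n : ℕ} (A : Fin n → ModuleCat.{u} K) (x : crossEffect Φ A) :
    crossEffectProj Φ A x.1 = x := by
  apply Subtype.ext
  change crossEffectIdempotent Φ A x.1 = x.1
  simp only [crossEffectIdempotent, LinearMap.sum_apply, LinearMap.smul_apply]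
  rw [Finset.sum_eq_single Finset.univ]
  · simp [keep_univ]
  · intro S _ hS
    obtain ⟨j, hj⟩ : ∃ j, j ∉ S := by simpa [Finset.eq_univ_iff_forall] using hS
    rw [← prHom_emHom_keep A S j hj, Φ.map_comp, ModuleCat.hom_comp, LinearMap.comp_apply,
      (mem_crossEffect Φ A x.1).1 x.2 j, map_zero, smul_zero]
  · simp

lemma emHom_keep {n : ℕ} (A : Fin n → ModuleCat.{u} K) (S T : Finset (Fin n)) (j : Fin n)
    (h : ∀ i ≠ j, i ∈ S ↔ i ∈ T) : emHom A j ≫ keep A S = emHom A j ≫ keep A T := by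
  apply ModuleCat.hom_ext
  refine LinearMap.ext fun a => funext fun i => ?_
  by_cases hij : i = j
  · by_cases hS : i ∈ S <;> by_cases hT : i ∈ T <;> simp_all [emHom, keep]
  · have := h i hij
    by_cases hi : i ∈ S <;> simp [emHom, keep, hi, ← this]

lemma crossEffectProj_emHom {n : ℕ} (A : Fin n → ModuleCat.{u} K) (j : Fin n)
    (x : Φ.obj (ModuleCat.of K (∀ i : {i // i ≠ j}, A i.1))) :
    crossEffectProj Φ A ((Φ.map (emHom A j)).hom x) = 0 := by
  apply Subtype.ext
  change crossEffectIdempotent Φ A ((Φ.map (emHom A j)).hom x) = 0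
  simp only [crossEffectIdempotent, LinearMap.sum_apply, LinearMap.smul_apply]
  refine signed_sum_eq_zero _ j fun S hS => ?_
  rw [← LinearMap.comp_apply, ← LinearMap.comp_apply, ← ModuleCat.hom_comp, ← ModuleCat.hom_comp,
    ← Φ.map_comp, ← Φ.map_comp, emHom_keep A (insert j S) S j fun i hi => by simp [hi]]

lemma prHom_emHom {n : ℕ} (A : Fin n → ModuleCat.{u} K) (S : Finset (Fin n)) (j : Fin n)
    (hj : j ∉ S) : keep A S ≫ prHom A j ≫ emHom A j = keep A S := by
  apply ModuleCat.hom_ext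
  refine LinearMap.ext fun a => funext fun i => ?_
  by_cases hi : i ∈ S
  · have : i ≠ j := by rintro rfl; exact hj hi
    simp [prHom, emHom, keep, hi, this]
  · by_cases hij : i = j
    · subst hij
      simp [prHom, emHom, keep, hi]
    · simp [prHom, emHom, keep, hi, hij]

lemma crossEffectProj_keep {n : ℕ} (A : Fin n → ModuleCat.{u} K) (S : Finset (Fin n))
    (hS : S ≠ Finset.univ) (x : Φ.obj (ModuleCat.of K (∀ i, A i))) :
    crossEffectProj Φ A ((Φ.map (keep A S)).hom x) = 0 := by
  obtain ⟨j, hj⟩ : ∃ j, j ∉ S := by simpa [Finset.eq_univ_iff_forall] using hS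
  rw [← prHom_emHom A S j hj, ← Category.assoc, Φ.map_comp, ModuleCat.hom_comp,
    LinearMap.comp_apply, crossEffectProj_emHom]

end CrossEffects

/-! ### The complex of cross effects of a module -/

section CrossEffectComplex

variable {K : Type u} [CommRing K] (Φ : ModuleCat.{u} K ⥤ ModuleCat.{u} K) (A : ModuleCat.{u} K)

/-- The map `Δⁱ : A^{n+1} → A^{n+2}`,
`(a₀, …, aₙ) ↦ (a₀, …, aᵢ₋₁, aᵢ, aᵢ, aᵢ₊₁, …, aₙ)`, that repeats the entry `aᵢ`. -/
def diag {n : ℕ} (i : Fin (n + 1)) :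
    ModuleCat.of K (Fin (n + 1) → A) ⟶ ModuleCat.of K (Fin (n + 2) → A) :=
  ModuleCat.ofHom (LinearMap.funLeft K A i.predAbove)

lemma diag_comp {n : ℕ} (i j : Fin (n + 1)) (h : i ≤ j) :
    diag A j ≫ diag A i.castSucc = diag A i ≫ diag A j.succ := by
  apply ModuleCat.hom_ext
  refine LinearMap.ext fun a => funext fun k => ?_
  change a (j.predAbove (i.castSucc.predAbove k)) = a (i.predAbove (j.succ.predAbove k))
  exact congrArg a (congr($(SimplexCategory.σ_comp_σ h).toOrderHom k))

lemma keep_diag {n : ℕ} (i : Fin (n + 1)) (S : Finset (Fin (n + 1))) :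
    keep (fun _ => A) S ≫ diag A i =
      diag A i ≫ keep (fun _ => A) (Finset.univ.filter fun k => i.predAbove k ∈ S) := by
  apply ModuleCat.hom_ext
  refine LinearMap.ext fun a => funext fun k => ?_
  by_cases hk : i.predAbove k ∈ S <;> simp [keep, diag, LinearMap.funLeft, hk]

/-- The `n`-th term `Φ(A|⋯|A)` of the complex, with `n + 1` entries `A`. -/
abbrev crossEffectTerm (n : ℕ) : ModuleCat.{u} K :=
  ModuleCat.of K (crossEffect Φ fun _ : Fin (n + 1) => A)

/-- The map `hⁱ`: the composition `Φ(A|⋯|A) ↣ Φ(A^{n+1}) → Φ(A^{n+2}) ↠ Φ(A|⋯|A)` of the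
inclusion, `Φ(Δⁱ)` and the projection. -/
def crossEffectCoface (n : ℕ) (i : Fin (n + 1)) :
    crossEffectTerm Φ A n ⟶ crossEffectTerm Φ A (n + 1) :=
  ModuleCat.ofHom
    (crossEffectProj Φ (fun _ : Fin (n + 2) => A) ∘ₗ (Φ.map (diag A i)).hom ∘ₗ
      (crossEffect Φ fun _ : Fin (n + 1) => A).subtype)

lemma crossEffectProj_diag (n : ℕ) (i : Fin (n + 1))
    (x : Φ.obj (ModuleCat.of K (Fin (n + 1) → A))) :
    crossEffectProj Φ (fun _ : Fin (n + 2) => A) ((Φ.map (diag A i)).hom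
      (crossEffectProj Φ (fun _ : Fin (n + 1) => A) x).1) =
    crossEffectProj Φ (fun _ : Fin (n + 2) => A) ((Φ.map (diag A i)).hom x) := by
  change crossEffectProj Φ (fun _ : Fin (n + 2) => A) ((Φ.map (diag A i)).hom
      (crossEffectIdempotent Φ (fun _ : Fin (n + 1) => A) x)) = _
  simp only [crossEffectIdempotent, LinearMap.sum_apply, LinearMap.smul_apply, map_sum, map_smul]
  rw [Finset.sum_eq_single Finset.univ]
  · simp [keep_univ]
  · intro S _ hS
    obtain ⟨j, hj⟩ : ∃ j, j ∉ S := by simpa [Finset.eq_univ_iff_forall] using hS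
    rw [← LinearMap.comp_apply (Φ.map (diag A i)).hom, ← ModuleCat.hom_comp, ← Φ.map_comp,
      keep_diag, Φ.map_comp, ModuleCat.hom_comp, LinearMap.comp_apply, crossEffectProj_keep,
      smul_zero]
    intro h
    rcases le_total j i with hji | hji
    · have := (Finset.eq_univ_iff_forall.1 h) j.castSucc
      simp [Fin.predAbove_castSucc_of_le i j hji, hj] at this
    · have := (Finset.eq_univ_iff_forall.1 h) j.succ
      simp [Fin.predAbove_succ_of_le i j hji, hj] at this
  · simp

lemma crossEffectCoface_comp (n : ℕ) (i j : Fin (n + 1)) (h : i ≤ j) :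
    crossEffectCoface Φ A n j ≫ crossEffectCoface Φ A (n + 1) i.castSucc =
      crossEffectCoface Φ A n i ≫ crossEffectCoface Φ A (n + 1) j.succ := by
  have key (a : Fin (n + 1)) (b : Fin (n + 2)) (x : crossEffectTerm Φ A n) :
      (crossEffectCoface Φ A n a ≫ crossEffectCoface Φ A (n + 1) b).hom x =
        crossEffectProj Φ (fun _ : Fin (n + 3) => A) ((Φ.map (diag A a ≫ diag A b)).hom x.1) := by
    refine (crossEffectProj_diag Φ A (n + 1) b ((Φ.map (diag A a)).hom x.1)).trans ?_
    rw [Φ.map_comp]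
    rfl
  apply ModuleCat.hom_ext
  refine LinearMap.ext fun x => ?_
  rw [key, key, diag_comp A i j h]

/-- The differential `∑ (-1)ⁱ hⁱ`. -/
def crossEffectD (n : ℕ) : crossEffectTerm Φ A n ⟶ crossEffectTerm Φ A (n + 1) :=
  ∑ i : Fin (n + 1), (-1 : ℤ) ^ (i : ℕ) • crossEffectCoface Φ A n i

lemma crossEffectD_comp (n : ℕ) : crossEffectD Φ A n ≫ crossEffectD Φ A (n + 1) = 0 := by
  simp only [crossEffectD, Preadditive.comp_sum, Preadditive.sum_comp, Preadditive.zsmul_comp,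
    Preadditive.comp_zsmul, smul_smul, Finset.smul_sum]
  simp only [← Finset.sum_product', Finset.univ_product_univ]
  let s : Finset (Fin (n + 2) × Fin (n + 1)) := {ba | (ba.1 : ℕ) ≤ (ba.2 : ℕ)}
  rw [← Finset.sum_add_sum_compl s, ← eq_neg_iff_add_eq_zero, ← Finset.sum_neg_distrib]
  refine Finset.sum_bij'
    (fun ba hba => (ba.2.succ, Fin.castLT ba.1 (lt_of_le_of_lt
      (Finset.mem_filter.mp hba).2 ba.2.is_lt)))
    (fun ba hba => (ba.2.castSucc, ba.1.pred (by
      rintro h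
      simp [s, h] at hba))) ?_ ?_ ?_ ?_ ?_
  · rintro ⟨b, a⟩ hba
    simp only [s, Finset.mem_filter_univ, Finset.mem_compl] at hba ⊢
    simp
    omega
  · rintro ⟨b, a⟩ hba
    simp only [s, Finset.mem_filter_univ, Finset.mem_compl] at hba ⊢
    simp
    omega
  · rintro ⟨b, a⟩ hba
    simp
  · rintro ⟨b, a⟩ hba
    simp
  · rintro ⟨b, a⟩ hba
    simp only [s, Finset.mem_filter_univ] at hba
    have h := crossEffectCoface_comp Φ A n (b.castLT (lt_of_le_of_lt hba a.is_lt)) a hba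
    rw [Fin.castSucc_castLT] at h
    simp only [h, ← neg_smul]
    congr 1
    simp [pow_succ, mul_comm]

/-- The complex `C_Φ(A) = C_Φ(id_A)`: `Φ(A) → Φ(A|A) → Φ(A|A|A) → ⋯`. -/
def crossEffectComplex : CochainComplex (ModuleCat.{u} K) ℕ :=
  CochainComplex.of (crossEffectTerm Φ A) (crossEffectD Φ A) (crossEffectD_comp Φ A)

variable {Φ A} {Ψ : ModuleCat.{u} K ⥤ ModuleCat.{u} K} {B : ModuleCat.{u} K}

/-- The map `f ⊕ ⋯ ⊕ f : Aⁿ → Bⁿ`. -/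
def powMap (f : A ⟶ B) (n : ℕ) : ModuleCat.of K (Fin n → A) ⟶ ModuleCat.of K (Fin n → B) :=
  ModuleCat.ofHom (LinearMap.pi fun j => f.hom ∘ₗ LinearMap.proj j)

/-- The map `Φ(Aⁿ) → Ψ(Bⁿ)` induced by `α : Φ ⟶ Ψ` and `f : A ⟶ B`. -/
def powApp (α : Φ ⟶ Ψ) (f : A ⟶ B) (n : ℕ) :
    Φ.obj (ModuleCat.of K (Fin n → A)) ⟶ Ψ.obj (ModuleCat.of K (Fin n → B)) :=
  Φ.map (powMap f n) ≫ α.app _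

lemma powApp_naturality (α : Φ ⟶ Ψ) (f : A ⟶ B) {m n : ℕ}
    (a : ModuleCat.of K (Fin m → A) ⟶ ModuleCat.of K (Fin n → A))
    (b : ModuleCat.of K (Fin m → B) ⟶ ModuleCat.of K (Fin n → B))
    (h : a ≫ powMap f n = powMap f m ≫ b) :
    Φ.map a ≫ powApp α f n = powApp α f m ≫ Ψ.map b := by
  simp only [powApp, Category.assoc]
  rw [← Category.assoc, ← Φ.map_comp, h, Φ.map_comp, Category.assoc, α.naturality]

lemma powApp_mem (α : Φ ⟶ Ψ) (f : A ⟶ B) (n : ℕ) :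
    ∀ x ∈ crossEffect Φ (fun _ : Fin n => A),
      (powApp α f n).hom x ∈ crossEffect Ψ (fun _ : Fin n => B) := by
  intro x hx
  rw [mem_crossEffect] at hx ⊢
  intro j
  have h : prHom (fun _ : Fin n => A) j ≫
      ModuleCat.ofHom (LinearMap.pi fun i => f.hom ∘ₗ LinearMap.proj i) =
      powMap f n ≫ prHom (fun _ : Fin n => B) j := rfl
  have h' : powApp α f n ≫ Ψ.map (prHom (fun _ : Fin n => B) j) =
      Φ.map (prHom (fun _ : Fin n => A) j) ≫
        Φ.map (ModuleCat.ofHom (LinearMap.pi fun i => f.hom ∘ₗ LinearMap.proj i)) ≫ α.app _ := by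
    rw [powApp, Category.assoc, ← α.naturality, ← Category.assoc, ← Φ.map_comp, ← h, Φ.map_comp,
      Category.assoc]
  have h2 := congr($(h').hom x)
  rw [ModuleCat.hom_comp, ModuleCat.hom_comp, LinearMap.comp_apply, LinearMap.comp_apply, hx j,
    map_zero] at h2
  exact h2

lemma powApp_proj (α : Φ ⟶ Ψ) (f : A ⟶ B) (n : ℕ)
    (x : Φ.obj (ModuleCat.of K (Fin n → A))) :
    (crossEffectProj Ψ (fun _ : Fin n => B) ((powApp α f n).hom x)).1 =
      (powApp α f n).hom (crossEffectProj Φ (fun _ : Fin n => A) x).1 := by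
  change crossEffectIdempotent Ψ (fun _ : Fin n => B) ((powApp α f n).hom x) =
    (powApp α f n).hom (crossEffectIdempotent Φ (fun _ : Fin n => A) x)
  simp only [crossEffectIdempotent, LinearMap.sum_apply, LinearMap.smul_apply, map_sum, map_smul]
  refine Finset.sum_congr rfl fun S _ => ?_
  have h := powApp_naturality α f (keep (fun _ : Fin n => A) S) (keep (fun _ : Fin n => B) S) (by
    apply ModuleCat.hom_ext
    refine LinearMap.ext fun a => funext fun k => ?_
    by_cases hk : k ∈ S <;> simp [keep, powMap, hk])
  exact congrArg _ congr($(h).hom x).symm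

/-- The morphism `C_Φ(A) ⟶ C_Ψ(B)` induced by `α : Φ ⟶ Ψ` and `f : A ⟶ B`. -/
def crossEffectComplexMap (α : Φ ⟶ Ψ) (f : A ⟶ B) :
    crossEffectComplex Φ A ⟶ crossEffectComplex Ψ B :=
  CochainComplex.ofHom
    (fun n => ModuleCat.ofHom ((powApp α f (n + 1)).hom.restrict (powApp_mem α f (n + 1))))
    (fun n => by
      simp only [crossEffectComplex, CochainComplex.of_d, crossEffectD, Preadditive.comp_sum,
        Preadditive.sum_comp, Preadditive.zsmul_comp, Preadditive.comp_zsmul]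
      refine Finset.sum_congr rfl fun i _ => congrArg _ ?_
      apply ModuleCat.hom_ext
      refine LinearMap.ext fun x => Subtype.ext ?_
      refine Eq.trans ?_ (powApp_proj α f (n + 2) ((Φ.map (diag A i)).hom x.1))
      have h := powApp_naturality α f (diag A i) (diag B i) rfl
      exact congrArg (fun y => (crossEffectProj Ψ (fun _ : Fin (n + 2) => B) y).1)
        congr($(h).hom x.1).symm)

end CrossEffectComplex

end RelLim

end

noncomputable section

namespace RelLim

open AlgebraicTopology AlternatingCofaceMapComplex

/-! The first part is a change of coordinates. For free `A` the module `R_A(id_A^n)` consists of the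
tuples in `A^{n+1}` with sum zero, and partial sums identify it with `A^n` (`relationsIso`). A
codegeneracy merges two neighbouring entries, so it deletes one partial sum; an inner coface inserts
a zero between two entries, so it repeats one partial sum; an outer coface produces a partial sum
equal to zero. Hence the normalised elements in degree `n + 1` form the cross effect with `n + 1`
entries, the outer cofaces die under the cross-effect projection, and the inner coface `i + 1`
becomes `h^i`. This index shift is the sign of `C[-1]`. In degree zero the complex is `Φ(0) = 0`.

For the second part, a presentation is weakly initial because free modules are projective, and its
copowers exist in `Pres A`. Exactness of the standard complex in a positive degree then forces the
derived limit in that degree to vanish (`isZero_rightDerived_lim`). The proof is a chase in the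
double complex of an injective resolution evaluated on the copowers: its rows are acyclic in
positive degrees because an injective functor is a retract of a coinduced one, where an extra
degeneracy exists.

By Dold–Kan it remains to see that normalised elements vanish above degree `d`. The kernels of the
codegeneracies on `R_A(p^n)` are the independent pieces of tuples `(0, …, x, -x, …, 0)`, for any
`A`. They yield a splitting of the identity into `d + 1` maps which sends a normalised element to a
cross effect of order `d + 1`, hence to zero (`IsPolynomialOfDegreeLE.normalized_eq_zero`). -/

/-! ### Exactness of the unnormalised complex from vanishing of the normalised part -/

lemma objD_apply {K : Type u} [CommRing K] (V : CosimplicialObject (ModuleCat.{v} K)) (n : ℕ)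
    (x : V.obj (SimplexCategory.mk n)) :
    (objD V n).hom x = ∑ i : Fin (n + 2), (-1 : ℤ) ^ (i : ℕ) • (V.δ i).hom x := by
  simp [objD, ModuleCat.hom_sum]

/-- Over the opposite category `V` becomes a simplicial object, where Dold–Kan gives a homotopy from
`PInfty` to the identity. Where `PInfty` kills a cocycle, the homotopy exhibits it as a coboundary.
-/
lemma exists_objD_eq_of_normalized {K : Type u} [CommRing K]
    (V : CosimplicialObject (ModuleCat.{v} K)) (n : ℕ)
    (hV : ∀ x : V.obj (SimplexCategory.mk (n + 1)), (∀ i : Fin (n + 1), (V.σ i).hom x = 0) → x = 0)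
    (x : V.obj (SimplexCategory.mk (n + 1))) (hx : (objD V (n + 1)).hom x = 0) :
    ∃ y, (objD V n).hom y = x := by
  let X : SimplicialObject (ModuleCat.{v} K)ᵒᵖ := Functor.op V
  let h := DoldKan.homotopyPInftyToId X
  have hd (m : ℕ) : ((AlternatingFaceMapComplex.obj X).d (m + 1) m).unop = objD V m := by
    rw [AlternatingFaceMapComplex.obj_d_eq, unop_sum]
    refine Finset.sum_congr rfl fun i _ => ?_
    rw [unop_zsmul]
    rfl
  -- Values of `PInfty` are killed by every codegeneracy.
  have hP : ((DoldKan.PInfty (X := X)).f (n + 1)).unop.hom x = 0 := by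
    refine hV _ fun i => ?_
    have := congr($(congrArg Quiver.Hom.unop (DoldKan.σ_comp_PInfty X i)).hom x)
    exact this
  have hc := congr($(congrArg Quiver.Hom.unop (h.comm (n + 1))).hom x)
  rw [Homotopy.dNext_succ_chainComplex, Homotopy.prevD_chainComplex, unop_add, unop_add,
    ModuleCat.hom_add, ModuleCat.hom_add, LinearMap.add_apply, LinearMap.add_apply, hP,
    unop_comp, unop_comp, hd, hd, ModuleCat.hom_comp, LinearMap.comp_apply,
    ModuleCat.hom_comp, LinearMap.comp_apply, hx, map_zero, add_zero] at hc
  refine ⟨-(h.hom n (n + 1)).unop.hom x, ?_⟩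
  rw [map_neg, neg_eq_iff_add_eq_zero]
  exact hc.symm

/-! ### Coinduced functors and acyclicity of injectives on copowers -/

/-- The functor `x ↦ ∏_d ∏_{f : x ⟶ d} G d`, coinduced from the discrete category. -/
def coinduced {K : Type u} [CommRing K] {C : Type (u + 1)} [Category.{u} C]
    (G : C → ModuleCat.{u + 1} K) : C ⥤ ModuleCat.{u + 1} K where
  obj x := ModuleCat.of K (∀ (d : C), (x ⟶ d) → G d)
  map g := ModuleCat.ofHom
    { toFun := fun w d f => w d (g ≫ f)
      map_add' := fun _ _ => rfl
      map_smul' := fun _ _ => rfl }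
  map_id x := by
    apply ModuleCat.hom_ext
    refine LinearMap.ext fun w => funext fun d => funext fun f => ?_
    exact congrArg (w d) (Category.id_comp f)
  map_comp g h := by
    apply ModuleCat.hom_ext
    refine LinearMap.ext fun w => funext fun d => funext fun f => ?_
    exact congrArg (w d) (Category.assoc g h f)

section

variable {K : Type u} [CommRing K] {C : Type (u + 1)} [Category.{u} C]

/-- The canonical monomorphism of a functor into a coinduced one. -/
def toCoinduced (F : C ⥤ ModuleCat.{u + 1} K) : F ⟶ coinduced F.obj where
  app x := ModuleCat.ofHom
    { toFun := fun a _ f => (F.map f).hom a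
      map_add' := fun a b => by ext; simp
      map_smul' := fun r a => by ext; simp }
  naturality x y g := by
    apply ModuleCat.hom_ext
    refine LinearMap.ext fun a => funext fun d => funext fun f => ?_
    change (F.map f).hom ((F.map g).hom a) = (F.map (g ≫ f)).hom a
    simp

instance (F : C ⥤ ModuleCat.{u + 1} K) : Mono (toCoinduced F) := by
  have : HasPullbacks (ModuleCat.{u + 1} K) := Abelian.hasPullbacks
  rw [NatTrans.mono_iff_mono_app]
  intro x
  rw [ModuleCat.mono_iff_injective]
  intro a b hab
  have := congrFun (congrFun hab x) (𝟙 x)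
  change (F.map (𝟙 x)).hom a = (F.map (𝟙 x)).hom b at this
  simpa using this

variable (c : C) (cof : ∀ n : ℕ, Cofan fun _ : Fin (n + 1) => c) (hc : ∀ n, IsColimit (cof n))

/-- The coface `c ⊔ ⋯ ⊔ c ⟶ c ⊔ ⋯ ⊔ c` that misses the `i`-th summand. -/
def copowerδ (n : ℕ) (i : Fin (n + 2)) : (cof n).pt ⟶ (cof (n + 1)).pt :=
  Cofan.IsColimit.desc (hc n) fun j => (cof (n + 1)).inj (i.succAbove j)

lemma inj_copowerδ (n : ℕ) (i : Fin (n + 2)) (j : Fin (n + 1)) :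
    (cof n).inj j ≫ copowerδ c cof hc n i = (cof (n + 1)).inj (i.succAbove j) :=
  Cofan.IsColimit.fac _ _ _

lemma inj_copowerδ_assoc (n : ℕ) (i : Fin (n + 2)) (j : Fin (n + 1)) {d : C}
    (f : (cof (n + 1)).pt ⟶ d) :
    (cof n).inj j ≫ copowerδ c cof hc n i ≫ f = (cof (n + 1)).inj (i.succAbove j) ≫ f := by
  rw [← Category.assoc, inj_copowerδ]

/-- The alternating sum of the maps `F (c ⊔ ⋯ ⊔ c) → F (c ⊔ ⋯ ⊔ c)` induced by the cofaces. -/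
def copowerD (F : C ⥤ ModuleCat.{u + 1} K) (n : ℕ) :
    F.obj (cof n).pt →ₗ[K] F.obj (cof (n + 1)).pt :=
  ∑ i : Fin (n + 2), (-1 : ℤ) ^ (i : ℕ) • (F.map (copowerδ c cof hc n i)).hom

lemma copowerD_apply (F : C ⥤ ModuleCat.{u + 1} K) (n : ℕ) (x : F.obj (cof n).pt) :
    copowerD c cof hc F n x =
      ∑ i : Fin (n + 2), (-1 : ℤ) ^ (i : ℕ) • (F.map (copowerδ c cof hc n i)).hom x := by
  simp [copowerD]

lemma copowerD_eq (F : C ⥤ ModuleCat.{u + 1} K) (n : ℕ) :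
    copowerD c cof hc F n =
      (objD (Functor.comp (copowers c cof hc) F : CosimplicialObject _) n).hom := by
  refine LinearMap.ext fun x => ?_
  rw [copowerD_apply]
  exact (objD_apply (K := K) (Functor.comp (copowers c cof hc) F : CosimplicialObject _) n x).symm

lemma copowerD_copowerD (F : C ⥤ ModuleCat.{u + 1} K) (n : ℕ) (x : F.obj (cof n).pt) :
    copowerD c cof hc F (n + 1) (copowerD c cof hc F n x) = 0 := by
  rw [copowerD_eq, copowerD_eq]
  exact congr($(d_squared (Functor.comp (copowers c cof hc) F : CosimplicialObject _) n).hom x)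

lemma copowerD_naturality {F G : C ⥤ ModuleCat.{u + 1} K} (α : F ⟶ G) (n : ℕ)
    (x : F.obj (cof n).pt) :
    copowerD c cof hc G n ((α.app _).hom x) = (α.app _).hom (copowerD c cof hc F n x) := by
  rw [copowerD_apply, copowerD_apply, map_sum]
  refine Finset.sum_congr rfl fun i _ => ?_
  rw [map_zsmul]
  exact congrArg _ congr($(α.naturality (copowerδ c cof hc n i)).hom x).symm

/-- Chosen maps `c ⟶ d` give an extra degeneracy: a map out of a copower is extended to one more
summand by the chosen map. The choices need not be natural in `d`, since elements of a coinduced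
functor satisfy no compatibility in `d`. -/
lemma exists_copowerD_coinduced (hw : ∀ x : C, Nonempty (c ⟶ x)) (G : C → ModuleCat.{u + 1} K)
    (n : ℕ) (x : (coinduced G).obj (cof (n + 1)).pt)
    (hx : copowerD c cof hc (coinduced G) (n + 1) x = 0) :
    ∃ y, copowerD c cof hc (coinduced G) n y = x := by
  let h (d : C) : c ⟶ d := (hw d).some
  let s (m : ℕ) (d : C) (f : (cof m).pt ⟶ d) : (cof (m + 1)).pt ⟶ d :=
    Cofan.IsColimit.desc (hc (m + 1)) (Fin.cons (h d) fun i => (cof m).inj i ≫ f)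
  have hs (m d f i) : (cof (m + 1)).inj i ≫ s m d f =
      (Fin.cons (h d) (fun i => (cof m).inj i ≫ f) : Fin (m + 2) → (c ⟶ d)) i :=
    Cofan.IsColimit.fac _ _ _
  have hs0 (m d f) : copowerδ c cof hc m 0 ≫ s m d f = f := by
    refine Cofan.IsColimit.hom_ext (hc m) _ _ fun i => ?_
    rw [inj_copowerδ_assoc, hs]
    simp
  have hs1 (m d) (f : (cof (m + 1)).pt ⟶ d) (k : Fin (m + 2)) :
      copowerδ c cof hc (m + 1) k.succ ≫ s (m + 1) d f = s m d (copowerδ c cof hc m k ≫ f) := by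
    refine Cofan.IsColimit.hom_ext (hc (m + 1)) _ _ fun i => ?_
    rw [inj_copowerδ_assoc, hs, hs]
    refine Fin.cases ?_ (fun i => ?_) i
    · simp
    · rw [Fin.succ_succAbove_succ, Fin.cons_succ, Fin.cons_succ, inj_copowerδ_assoc]
  refine ⟨fun d f => x d (s n d f), ?_⟩
  funext d f
  -- Evaluated at the extended map `s (n + 1) d f`, the cocycle condition expresses `x d f` as the
  -- coboundary of `x ∘ s`: the coface `0` returns `f`, and the others commute with `s` up to an
  -- index shift.
  have h1 := congrFun (congrFun hx d) (s (n + 1) d f)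
  have h2 (m) (w : (coinduced G).obj (cof m).pt) (g) : copowerD c cof hc (coinduced G) m w d g =
        ∑ i : Fin (m + 2), (-1 : ℤ) ^ (i : ℕ) • w d (copowerδ c cof hc m i ≫ g) := by
    rw [copowerD_apply]
    refine (congrFun (Finset.sum_apply d _ _) g).trans ((Finset.sum_apply g _ _).trans ?_)
    rfl
  rw [h2, Fin.sum_univ_succ] at h1
  refine (h2 n (fun d f => x d (s n d f)) f).trans ?_
  simp only [hs0, hs1, Fin.val_succ, pow_succ, mul_neg, mul_one, neg_smul,
    Finset.sum_neg_distrib, Fin.val_zero, pow_zero, one_smul] at h1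
  exact (add_neg_eq_zero.1 h1).symm

/-- Injectivity splits `toCoinduced I`, and exactness passes to retracts. -/
lemma exists_copowerD_injective (hw : ∀ x : C, Nonempty (c ⟶ x)) (I : C ⥤ ModuleCat.{u + 1} K)
    [Injective I] (n : ℕ) (x : I.obj (cof (n + 1)).pt) (hx : copowerD c cof hc I (n + 1) x = 0) :
    ∃ y, copowerD c cof hc I n y = x := by
  let r : coinduced I.obj ⟶ I := Injective.factorThru (𝟙 I) (toCoinduced I)
  have hr : toCoinduced I ≫ r = 𝟙 I := Injective.comp_factorThru _ _
  obtain ⟨y, hy⟩ := exists_copowerD_coinduced c cof hc hw I.obj n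
    (((toCoinduced I).app _).hom x) (by rw [copowerD_naturality, hx, map_zero])
  refine ⟨(r.app _).hom y, ?_⟩
  rw [copowerD_naturality, hy]
  exact congr($(congr_app hr _).hom x)

/-- The maps `f` and `g` combine to one map `t` out of the binary copower; `F.map t` carries the
equality of the two cofaces of `x` to the claim. -/
lemma map_eq_of_copowerD_eq_zero (F : C ⥤ ModuleCat.{u + 1} K) (x : F.obj (cof 0).pt)
    (hx : copowerD c cof hc F 0 x = 0) {d : C} (f g : (cof 0).pt ⟶ d) :
    (F.map f).hom x = (F.map g).hom x := by
  let t : (cof 1).pt ⟶ d := Cofan.IsColimit.desc (hc 1)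
    (Fin.cons ((cof 0).inj 0 ≫ g) fun _ => (cof 0).inj 0 ≫ f)
  have ht (i) : (cof 1).inj i ≫ t = (Fin.cons ((cof 0).inj 0 ≫ g)
      fun _ => (cof 0).inj 0 ≫ f : Fin 2 → (c ⟶ d)) i := Cofan.IsColimit.fac _ _ _
  have h0 : copowerδ c cof hc 0 0 ≫ t = f := by
    refine Cofan.IsColimit.hom_ext (hc 0) _ _ fun i => ?_
    fin_cases i
    rw [inj_copowerδ_assoc, ht]
    rfl
  have h1 : copowerδ c cof hc 0 1 ≫ t = g := by
    refine Cofan.IsColimit.hom_ext (hc 0) _ _ fun i => ?_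
    fin_cases i
    rw [inj_copowerδ_assoc, ht]
    rfl
  have := congrArg (F.map t).hom hx
  rw [copowerD_apply, Fin.sum_univ_two, map_add, map_zero, map_zsmul, map_zsmul,
    ← LinearMap.comp_apply, ← LinearMap.comp_apply, ← ModuleCat.hom_comp, ← ModuleCat.hom_comp,
    ← F.map_comp, ← F.map_comp, h0, h1] at this
  simpa [← sub_eq_add_neg, sub_eq_zero] using this

/-- The degree-zero cocycles form the vertex of a cone: transport along any map to `d` gives the
same element, so arbitrary choices are compatible. -/
lemma exists_limit_of_copowerD_eq_zero (hw : ∀ x : C, Nonempty (c ⟶ x))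
    (F : C ⥤ ModuleCat.{u + 1} K) (x : F.obj (cof 0).pt) (hx : copowerD c cof hc F 0 x = 0) :
    ∃ z : (limit F : ModuleCat.{u + 1} K), (limit.π F (cof 0).pt).hom z = x := by
  let s (d : C) : (cof 0).pt ⟶ d := Cofan.IsColimit.desc (hc 0) fun _ => (hw d).some
  let S : Cone F :=
    { pt := ModuleCat.of K (LinearMap.ker (copowerD c cof hc F 0))
      π :=
        { app := fun d => ModuleCat.ofHom ((F.map (s d)).hom ∘ₗ Submodule.subtype _)
          naturality := fun d e f => by
            apply ModuleCat.hom_ext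
            refine LinearMap.ext fun y => ?_
            change (F.map (s e)).hom y.1 = (F.map f).hom ((F.map (s d)).hom y.1)
            rw [← LinearMap.comp_apply, ← ModuleCat.hom_comp, ← F.map_comp]
            exact map_eq_of_copowerD_eq_zero c cof hc F y.1 y.2 _ _ } }
  refine ⟨(limit.lift F S).hom ⟨x, hx⟩, ?_⟩
  rw [← LinearMap.comp_apply, ← ModuleCat.hom_comp, limit.lift_π]
  change (F.map (s (cof 0).pt)).hom x = x
  rw [map_eq_of_copowerD_eq_zero c cof hc F x hx (s (cof 0).pt) (𝟙 _)]
  simp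

lemma copowerD_limit_π (F : C ⥤ ModuleCat.{u + 1} K) (z : (limit F : ModuleCat.{u + 1} K)) :
    copowerD c cof hc F 0 ((limit.π F (cof 0).pt).hom z) = 0 := by
  rw [copowerD_apply, Fin.sum_univ_two]
  simp only [← LinearMap.comp_apply, ← ModuleCat.hom_comp, limit.w]
  simp

lemma limit_ext_of_weaklyInitial {c : C} (hw : ∀ x : C, Nonempty (c ⟶ x))
    (F : C ⥤ ModuleCat.{u + 1} K) (y z : (limit F : ModuleCat.{u + 1} K))
    (h : (limit.π F c).hom y = (limit.π F c).hom z) : y = z := by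
  refine Concrete.limit_ext F y z fun d => ?_
  obtain ⟨f⟩ := hw d
  have := congrArg (F.map f).hom h
  rw [← LinearMap.comp_apply, ← LinearMap.comp_apply, ← ModuleCat.hom_comp, limit.w] at this
  exact this

lemma exists_copowerD_of_iso {F G : C ⥤ ModuleCat.{u + 1} K} (e : F ≅ G) (n : ℕ)
    (hF : ∀ x, copowerD c cof hc F (n + 1) x = 0 → ∃ y, copowerD c cof hc F n y = x)
    (x : G.obj (cof (n + 1)).pt) (hx : copowerD c cof hc G (n + 1) x = 0) :
    ∃ y, copowerD c cof hc G n y = x := by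
  obtain ⟨y, hy⟩ := hF ((e.inv.app _).hom x) (by rw [copowerD_naturality, hx, map_zero])
  refine ⟨(e.hom.app _).hom y, ?_⟩
  rw [copowerD_naturality, hy]
  exact congr($(congr_app e.inv_hom_id _).hom x)

lemma exact_app {S : ShortComplex (C ⥤ ModuleCat.{u + 1} K)} (hS : S.Exact) (d : C)
    (x : S.X₂.obj d) (hx : (S.g.app d).hom x = 0) : ∃ y, (S.f.app d).hom y = x := by
  have : HasFiniteLimits (ModuleCat.{u + 1} K) := Abelian.hasFiniteLimits
  exact (ShortComplex.moduleCat_exact_iff _).1 (hS.map ((evaluation C (ModuleCat.{u + 1} K)).obj d)) x hx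

end

/-! ### Comparison of derived limits with the standard complex -/

section

variable {K : Type u} [CommRing K] {C : Type (u + 1)} [Category.{u} C]
  (c : C) (cof : ∀ n : ℕ, Cofan fun _ : Fin (n + 1) => c) (hc : ∀ n, IsColimit (cof n))

/-- Dimension shifting. Let `Z^m` be the kernel of `I^m → I^{m+1}`, so that `Z^0 = F` and `0 → Z^m →
I^m → Z^{m+1} → 0` is exact. As `I^m` is acyclic on copowers in positive degrees, exactness of `F`
in degree `n + m + 1` descends to exactness of `Z^m` in degree `n + 1`. -/
lemma exists_cocycle_copowerD_eq (hw : ∀ x : C, Nonempty (c ⟶ x)) {F : C ⥤ ModuleCat.{u + 1} K}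
    (I : InjectiveResolution F) (m : ℕ) : ∀ (n : ℕ)
    (_ : ∀ x, copowerD c cof hc F (n + m + 1) x = 0 → ∃ y, copowerD c cof hc F (n + m) y = x)
    (x : (I.cocomplex.X m).obj (cof (n + 1)).pt)
    (_ : ((I.cocomplex.d m (m + 1)).app _).hom x = 0)
    (_ : copowerD c cof hc (I.cocomplex.X m) (n + 1) x = 0),
    ∃ y, ((I.cocomplex.d m (m + 1)).app _).hom y = 0 ∧
      copowerD c cof hc (I.cocomplex.X m) n y = x := by
  induction m with
  | zero =>
    intro n hF x hdx hx
    -- The resolution is augmented by the degree-zero term of a single complex, which is identified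
    -- with `F` through the isomorphism `e`.
    let F' := ((CochainComplex.single₀ (C ⥤ ModuleCat.{u + 1} K)).obj F).X 0
    let e : F ≅ F' := (HomologicalComplex.singleObjXSelf (ComplexShape.up ℕ) 0 F).symm
    let ι : F' ⟶ I.cocomplex.X 0 := I.ι.f 0
    have hι : Function.Injective (ι.app (cof (n + 1 + 1)).pt).hom := by
      have : HasPullbacks (ModuleCat.{u + 1} K) := Abelian.hasPullbacks
      have h : Mono ι := inferInstanceAs (Mono (I.ι.f 0))
      rw [NatTrans.mono_iff_mono_app] at h
      exact (ModuleCat.mono_iff_injective _).1 (h _)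
    obtain ⟨z, hz⟩ := exact_app I.exact₀ _ x hdx
    change F'.obj _ at z
    change (ι.app _).hom z = x at hz
    have hz' : copowerD c cof hc F' (n + 1) z = 0 := by
      apply hι
      rw [← copowerD_naturality, hz, hx, map_zero]
    obtain ⟨y, hy⟩ := exists_copowerD_of_iso c cof hc e n hF z hz'
    refine ⟨(ι.app _).hom y, ?_, ?_⟩
    · exact congr($(congr_app I.ι_f_zero_comp_complex_d _).hom y)
    · rw [copowerD_naturality, hy, hz]
  | succ m ih =>
    intro n hF x hdx hx
    obtain ⟨v, hv⟩ := exact_app (I.exact_succ m) _ x hdx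
    change (I.cocomplex.X m).obj _ at v
    change ((I.cocomplex.d m (m + 1)).app _).hom v = x at hv
    -- The coboundary of the lift `v` is a cocycle of `Z^m` one degree higher; correcting `v` by `z`
    -- makes it a cocycle of `I^m`.
    obtain ⟨z, hz, hz'⟩ := ih (n + 1) (by rwa [add_right_comm n 1 m])
      (copowerD c cof hc _ _ v) (by rw [← copowerD_naturality, hv, hx])
      (copowerD_copowerD _ _ _ _ _ _)
    obtain ⟨y, hy⟩ := exists_copowerD_injective c cof hc hw (I.cocomplex.X m) n (v - z) (by
      rw [map_sub, hz', sub_self])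
    refine ⟨((I.cocomplex.d m (m + 1)).app _).hom y, ?_, ?_⟩
    · exact congr($(congr_app (I.cocomplex.d_comp_d m (m + 1) (m + 2)) _).hom y)
    · rw [copowerD_naturality, hy, map_sub, hz, sub_zero, hv]

/-- A cocycle of `lim I` is determined by its component at the weakly initial object. That component
lifts to `I^m`, and the previous lemma with `n = 0` corrects the lift so that it comes from `lim
I^m`. -/
lemma isZero_rightDerived_lim (hw : ∀ x : C, Nonempty (c ⟶ x)) (F : C ⥤ ModuleCat.{u + 1} K)
    (m : ℕ)
    (hF : ∀ x, copowerD c cof hc F (m + 1) x = 0 → ∃ y, copowerD c cof hc F m y = x) :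
    IsZero (((lim : (C ⥤ ModuleCat.{u + 1} K) ⥤ ModuleCat.{u + 1} K).rightDerived
      (m + 1)).obj F) := by
  let I := injectiveResolution F
  refine IsZero.of_iso ?_ (I.isoRightDerivedObj lim (m + 1))
  refine (HomologicalComplex.exactAt_iff_isZero_homology _ _).1 ?_
  rw [HomologicalComplex.exactAt_iff' _ m (m + 1) (m + 2) (by simp) (by simp)]
  rw [ShortComplex.moduleCat_exact_iff]
  intro x hdx
  change (limit (I.cocomplex.X (m + 1)) : ModuleCat.{u + 1} K) at x
  change (lim.map (I.cocomplex.d (m + 1) (m + 2))).hom x = 0 at hdx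
  change ∃ y : (limit (I.cocomplex.X m) : ModuleCat.{u + 1} K),
    (lim.map (I.cocomplex.d m (m + 1))).hom y = x
  have hπ (k) (y : (limit (I.cocomplex.X k) : ModuleCat.{u + 1} K)) :
      (limit.π (I.cocomplex.X (k + 1)) (cof 0).pt).hom
        ((lim.map (I.cocomplex.d k (k + 1))).hom y) =
      ((I.cocomplex.d k (k + 1)).app _).hom ((limit.π (I.cocomplex.X k) (cof 0).pt).hom y) :=
    congr($(limMap_π (I.cocomplex.d k (k + 1)) (cof 0).pt).hom y)
  obtain ⟨v, hv⟩ := exact_app (I.exact_succ m) _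
    ((limit.π (I.cocomplex.X (m + 1)) (cof 0).pt).hom x) (by
      refine (hπ (m + 1) x).symm.trans ?_
      rw [hdx, map_zero])
  change (I.cocomplex.X m).obj _ at v
  change ((I.cocomplex.d m (m + 1)).app _).hom v = _ at hv
  obtain ⟨z, hz, hz'⟩ := exists_cocycle_copowerD_eq c cof hc hw I m 0 (by rwa [zero_add])
    (copowerD c cof hc _ _ v)
    (by rw [← copowerD_naturality, hv, copowerD_limit_π]) (copowerD_copowerD _ _ _ _ _ _)
  obtain ⟨y, hy⟩ := exists_limit_of_copowerD_eq_zero c cof hc hw _ (v - z) (by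
    rw [map_sub, hz', sub_self])
  refine ⟨y, limit_ext_of_weaklyInitial (c := (cof 0).pt)
    (fun d => ⟨Cofan.IsColimit.desc (hc 0) fun _ => (hw d).some⟩) _ _ _ ?_⟩
  rw [hπ, hy, map_sub, hz, sub_zero, hv]

/-- The derived limits of `F` vanish in degree `m + 1` if the standard complex of `F` at a weakly
initial object has no nonzero elements in this degree. -/
lemma isZero_higherLim (hw : ∀ x : C, Nonempty (c ⟶ x)) (F : C ⥤ ModuleCat.{u} K) (m : ℕ)
    (hF : ∀ x ∈ normalizedSubmodule (Functor.comp (copowers c cof hc) F : CosimplicialObject _)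
      (m + 1), x = 0) :
    IsZero (higherLim F (m + 1)) := by
  refine isZero_rightDerived_lim c cof hc hw _ m fun x hx => ?_
  rw [copowerD_eq] at hx
  -- The universe lift leaves the codegeneracies unchanged, so normalised elements can be tested
  -- before lifting.
  obtain ⟨y, hy⟩ := exists_objD_eq_of_normalized (K := K)
    (Functor.comp (copowers c cof hc) (F ⋙ ModuleCat.uliftFunctor.{u + 1, u} K) :
      CosimplicialObject _) m (fun z hz => ULift.ext _ _ (hF z.down (by
        simp only [normalizedSubmodule, Submodule.mem_iInf, LinearMap.mem_ker]
        exact fun i => congrArg ULift.down (hz i)))) x hx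
  refine ⟨y, ?_⟩
  rw [copowerD_eq]
  exact hy

end

/-! ### Partial-sum coordinates on tuples -/

section PartialSums

variable {K : Type u} [CommRing K] {M N : Type u} [AddCommGroup M] [Module K M]
  [AddCommGroup N] [Module K N]

variable (K M) in
/-- The map `Mᵐ → Mⁿ` that sends the `i`-th summand identically to the `θ i`-th one. -/
abbrev pushforward {m n : ℕ} (θ : Fin m → Fin n) : (Fin m → M) →ₗ[K] (Fin n → M) :=
  sumMap fun i => LinearMap.single K (fun _ : Fin n => M) (θ i)

lemma pushforward_apply {m n : ℕ} (θ : Fin m → Fin n) (a : Fin m → M) (k : Fin n) :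
    pushforward K M θ a k = ∑ j, if θ j = k then a j else 0 := by
  simp [pushforward, sumMap_apply, Pi.single_apply, eq_comm]

variable (K M) in
/-- The map `(a₀, …, aₙ) ↦ (a₀, a₀ + a₁, …, a₀ + ⋯ + aₙ₋₁)`. -/
def partialSums (n : ℕ) : (Fin (n + 1) → M) →ₗ[K] (Fin n → M) :=
  LinearMap.pi fun i => ∑ j ∈ Finset.Iic i.castSucc, LinearMap.proj j

variable (K M) in
/-- The map `(y₀, …, yₙ₋₁) ↦ (y₀, y₁ - y₀, …, yₙ₋₁ - yₙ₋₂, -yₙ₋₁)`. -/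
def differences (n : ℕ) : (Fin n → M) →ₗ[K] (Fin (n + 1) → M) :=
  sumMap fun i => LinearMap.single K (fun _ : Fin (n + 1) => M) i.castSucc -
    LinearMap.single K (fun _ : Fin (n + 1) => M) i.succ

lemma partialSums_apply (n : ℕ) (a : Fin (n + 1) → M) (i : Fin n) :
    partialSums K M n a i = ∑ j ∈ Finset.Iic i.castSucc, a j := by
  simp [partialSums]

lemma partialSums_apply' (n : ℕ) (a : Fin (n + 1) → M) (i : Fin n) :
    partialSums K M n a i = ∑ j, if j ≤ i.castSucc then a j else 0 := by
  rw [partialSums_apply, ← Finset.sum_filter]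
  refine Finset.sum_congr ?_ fun _ _ => rfl
  ext
  simp

lemma partialSums_single (n : ℕ) (j : Fin (n + 1)) (x : M) (i : Fin n) :
    partialSums K M n (Pi.single j x) i = if j ≤ i.castSucc then x else 0 := by
  simp [partialSums_apply, Pi.single_apply]

lemma differences_single (n : ℕ) (i : Fin n) (x : M) :
    differences K M n (Pi.single i x) = Pi.single i.castSucc x - Pi.single i.succ x :=
  sumMap_single _ _ _

lemma partialSums_differences_single (n : ℕ) (i : Fin n) (x : M) :
    partialSums K M n (Pi.single i.castSucc x - Pi.single i.succ x) = Pi.single i x := by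
  funext k
  rw [map_sub, Pi.sub_apply, partialSums_single, partialSums_single, Pi.single_apply]
  simp only [Fin.castSucc_le_castSucc_iff, Fin.succ_le_castSucc_iff]
  rcases lt_trichotomy i k with h | h | h
  · simp [h, h.le, h.ne']
  · simp [h]
  · simp [h.not_ge, h.not_gt, h.ne]

lemma partialSums_differences (n : ℕ) (y : Fin n → M) :
    partialSums K M n (differences K M n y) = y := by
  have : partialSums K M n ∘ₗ differences K M n = LinearMap.id :=
    LinearMap.pi_ext fun i x => by
      rw [LinearMap.comp_apply, differences_single, partialSums_differences_single]
      rfl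
  exact congr($this y)

/-- Downward induction on `j`: at the last index every recorded partial sum is zero, since the total
sum is not recorded, and each step down adds one telescoping term. -/
lemma differences_partialSums_single (n : ℕ) (j : Fin (n + 1)) (x : M) :
    differences K M n (partialSums K M n (Pi.single j x)) =
      Pi.single j x - Pi.single (Fin.last n) x := by
  induction j using Fin.reverseInduction with
  | last =>
    have : partialSums K M n (Pi.single (Fin.last n) x) = 0 := by
      funext k
      rw [partialSums_single, if_neg (Fin.castSucc_lt_last k).not_ge]
      rfl
    rw [this, map_zero, sub_self]
  | cast j ih =>
    have h := partialSums_differences_single (K := K) n j x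
    rw [map_sub, sub_eq_iff_eq_add] at h
    rw [h, map_add, ih, differences_single, sub_add_sub_cancel]

lemma differences_partialSums (n : ℕ) (a : Fin (n + 1) → M) (ha : ∑ j, a j = 0) :
    differences K M n (partialSums K M n a) = a := by
  have : differences K M n ∘ₗ partialSums K M n = LinearMap.id -
      LinearMap.single K (fun _ : Fin (n + 1) => M) (Fin.last n) ∘ₗ ∑ j, LinearMap.proj j :=
    LinearMap.pi_ext fun i x => by
      rw [LinearMap.comp_apply, differences_partialSums_single]
      simp
  have h := congr($this a)
  simpa [ha] using h

lemma partialSums_pushforward {m n : ℕ} (θ : Fin (m + 1) → Fin (n + 1)) (a : Fin (m + 1) → M)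
    (k : Fin n) :
    partialSums K M n (pushforward K M θ a) k = ∑ j, if θ j ≤ k.castSucc then a j else 0 := by
  rw [partialSums_apply]
  simp only [pushforward_apply]
  rw [Finset.sum_comm]
  refine Finset.sum_congr rfl fun j _ => ?_
  simp

/-- Merging the entries `i` and `i + 1` loses exactly the partial sum that ends between them. -/
lemma partialSums_pushforward_predAbove {n : ℕ} (i : Fin (n + 1)) (a : Fin (n + 2) → M) :
    partialSums K M n (pushforward K M i.predAbove a) =
      fun k => partialSums K M (n + 1) a (i.succAbove k) := by
  funext k
  rw [partialSums_pushforward, partialSums_apply']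
  refine Finset.sum_congr rfl fun j _ => if_congr ?_ rfl rfl
  simp only [Fin.predAbove, Fin.succAbove, Fin.le_def, Fin.lt_def, Fin.val_castSucc]
  split_ifs <;> simp <;> omega

/-- The indices `i.succ.castSucc` are those of the inner cofaces; a zero inserted after entry `i`
repeats the `i`-th partial sum. -/
lemma partialSums_pushforward_succAbove {n : ℕ} (i : Fin (n + 1)) (a : Fin (n + 2) → M) :
    partialSums K M (n + 2) (pushforward K M i.succ.castSucc.succAbove a) =
      fun k => partialSums K M (n + 1) a (i.predAbove k) := by
  funext k
  rw [partialSums_pushforward, partialSums_apply']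
  refine Finset.sum_congr rfl fun j _ => if_congr ?_ rfl rfl
  simp only [Fin.predAbove, Fin.succAbove, Fin.le_def, Fin.lt_def, Fin.val_castSucc, Fin.val_succ]
  split_ifs <;> simp <;> omega

lemma partialSums_pushforward_zero {n : ℕ} (a : Fin (n + 2) → M) :
    partialSums K M (n + 2) (pushforward K M (Fin.succAbove 0) a) 0 = 0 := by
  rw [partialSums_pushforward]
  exact Finset.sum_eq_zero fun j _ => by simp

lemma partialSums_pushforward_last {n : ℕ} (a : Fin (n + 2) → M) (ha : ∑ j, a j = 0) :
    partialSums K M (n + 2) (pushforward K M (Fin.last (n + 2)).succAbove a)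
      (Fin.last (n + 1)) = 0 := by
  rw [partialSums_pushforward, ← ha]
  exact Finset.sum_congr rfl fun j _ => by simp [Fin.le_last]

lemma partialSums_map (g : M →ₗ[K] N) (n : ℕ) (a : Fin (n + 1) → M) :
    partialSums K N n (fun j => g (a j)) = fun k => g (partialSums K M n a k) := by
  funext k
  simp [partialSums_apply]

/-- Pushing forward preserves the total sum, so `a` has sum zero and is recovered from its partial
sums, of which only the `i`-th can be nonzero. No condition modulo `A` enters, so this also serves
presentations of non-free modules. -/
lemma eq_of_pushforward_predAbove_eq_zero {n : ℕ} (i : Fin (n + 1)) (a : Fin (n + 2) → M)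
    (ha : pushforward K M i.predAbove a = 0) :
    ∃ x, a = Pi.single i.castSucc x - Pi.single i.succ x := by
  have hs : ∑ j, a j = 0 := by
    have : ∑ k, pushforward K M i.predAbove a k = ∑ j, a j := by
      simp only [pushforward_apply]
      rw [Finset.sum_comm]
      simp
    rw [← this, ha]
    simp
  refine ⟨partialSums K M (n + 1) a i, ?_⟩
  rw [← differences_single (K := K), ← differences_partialSums (K := K) _ a hs]
  congr 1
  have h := partialSums_pushforward_predAbove (K := K) i a
  rw [ha, map_zero] at h
  rw [differences_partialSums (K := K) _ a hs]
  funext k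
  by_cases hk : k = i
  · subst hk
    simp
  · obtain ⟨k, rfl⟩ := Fin.exists_succAbove_eq hk
    rw [Pi.single_eq_of_ne hk]
    exact (congrFun h k).symm

end PartialSums

/-! ### Vanishing of normalised elements for polynomial functors -/

section Polynomial

variable {K : Type u} [CommRing K]

/-- An element of `Φ M` vanishes if it is killed by retractions `q j` of `M`, `0 ≤ j ≤ d`, for
which the identity of `M` is a sum of maps `t j` such that `t i` factors through `q j` for `i ≠ j`,
when `Φ` is polynomial of degree `≤ d`. -/
lemma IsPolynomialOfDegreeLE.eq_zero {Φ : ModuleCat.{u} K ⥤ ModuleCat.{u} K} {d : ℕ}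
    (hΦ : IsPolynomialOfDegreeLE Φ d) {M : ModuleCat.{u} K} (t : Fin (d + 1) → (M ⟶ M))
    (ht : ∑ j, t j = 𝟙 M) (N : Fin (d + 1) → ModuleCat.{u} K) (q : ∀ j, M ⟶ N j)
    (s : ∀ j, N j ⟶ M) (h : ∀ i j, i ≠ j → q j ≫ s j ≫ t i = t i) (x : Φ.obj M)
    (hx : ∀ j, (Φ.map (q j)).hom x = 0) : x = 0 := by
  let θ : M ⟶ ModuleCat.of K (∀ _ : Fin (d + 1), M) :=
    ModuleCat.ofHom (LinearMap.pi fun j => (t j).hom)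
  let ρ : ModuleCat.of K (∀ _ : Fin (d + 1), M) ⟶ M :=
    ModuleCat.ofHom (sumMap fun _ => LinearMap.id)
  have hρ : θ ≫ ρ = 𝟙 M := by
    rw [← ht]
    apply ModuleCat.hom_ext
    refine LinearMap.ext fun a => (sumMap_apply _ _).trans ?_
    rw [ModuleCat.hom_sum, LinearMap.sum_apply]
    rfl
  have hθ : (Φ.map θ).hom x ∈ crossEffect Φ fun _ : Fin (d + 1) => M := by
    rw [mem_crossEffect]
    intro j
    -- Dropping the `j`-th copy of `M` leaves only the maps `t i` with `i ≠ j`, all of which factor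
    -- through `q j`.
    have hj : q j ≫ s j ≫ θ ≫ prHom (fun _ => M) j = θ ≫ prHom (fun _ => M) j := by
      apply ModuleCat.hom_ext
      refine LinearMap.ext fun a => funext fun i => ?_
      exact congr($(h i.1 j i.2).hom a)
    rw [← LinearMap.comp_apply, ← ModuleCat.hom_comp, ← Φ.map_comp, ← hj, Φ.map_comp,
      ModuleCat.hom_comp, LinearMap.comp_apply, hx, map_zero]
  rw [hΦ, Submodule.mem_bot] at hθ
  have := congrArg (Φ.map ρ).hom hθ
  rw [← LinearMap.comp_apply, ← ModuleCat.hom_comp, ← Φ.map_comp, hρ, map_zero] at this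
  simpa using this

variable {A : ModuleCat.{u} K} (p : Pres A)

/-- The cosimplicial object `p^•` in the category of presentations. -/
abbrev presCopowers : SimplexCategory ⥤ Pres A :=
  copowers p (copowerCofan p) (copowerCofanIsColimit p)

/-- The cosimplicial module `R_A (p^•)`. -/
abbrev relations : SimplexCategory ⥤ ModuleCat.{u} K := presCopowers p ⋙ relationFunctor A

lemma relations_map_val {m n : SimplexCategory} (θ : m ⟶ n) (a : (relations p).obj m) :
    (((relations p).map θ).hom a).1 = pushforward K p.obj.left θ.toOrderHom a.1 := rfl

/-- The module `R_A (pⁿ)` as a submodule of `F ⊕ ⋯ ⊕ F`. -/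
abbrev relationsSubmodule (n : ℕ) : Submodule K (Fin (n + 1) → p.obj.left) :=
  LinearMap.ker (sumMap fun _ => p.obj.hom.hom)

lemma mem_relationsSubmodule (n : ℕ) (a : Fin (n + 1) → p.obj.left) :
    a ∈ relationsSubmodule p n ↔ ∑ j, p.obj.hom.hom (a j) = 0 := by
  rw [LinearMap.mem_ker, sumMap_apply]

/-- The endomorphism of `Ker (F ⊕ ⋯ ⊕ F → A)` given by
`a ↦ (0, …, 0, yᵢ, -yᵢ, 0, …, 0)` with `yᵢ = a₀ + ⋯ + aᵢ`. -/
def relationsProj (n : ℕ) (i : Fin n) :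
    (relations p).obj (SimplexCategory.mk n) ⟶ (relations p).obj (SimplexCategory.mk n) :=
  ModuleCat.ofHom (LinearMap.restrict
    (p := relationsSubmodule p n) (q := relationsSubmodule p n)
    (differences K p.obj.left n ∘ₗ LinearMap.single K (fun _ : Fin n => p.obj.left) i ∘ₗ
      LinearMap.proj i ∘ₗ partialSums K p.obj.left n) fun a _ => by
    rw [mem_relationsSubmodule, ← map_sum]
    simp [differences_single])

lemma relationsProj_val (n : ℕ) (i : Fin n) (a : (relations p).obj (SimplexCategory.mk n)) :
    ((relationsProj p n i).hom a).1 =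
      differences K p.obj.left n (Pi.single i (partialSums K p.obj.left n a.1 i)) := rfl

lemma relationsProj_eq_zero (n : ℕ) {i j : Fin (n + 1)} (hij : i ≠ j)
    (a : (relations p).obj (SimplexCategory.mk (n + 1)))
    (ha : ((relations p).map (SimplexCategory.σ j)).hom a = 0) :
    (relationsProj p (n + 1) i).hom a = 0 := by
  apply Subtype.ext
  obtain ⟨x, hx⟩ := eq_of_pushforward_predAbove_eq_zero (K := K) j a.1
    ((relations_map_val p (SimplexCategory.σ j) a).symm.trans (congrArg Subtype.val ha))
  rw [relationsProj_val, hx, partialSums_differences_single, Pi.single_eq_of_ne hij,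
    Pi.single_zero, map_zero]
  rfl

lemma relationsProj_eq_self (n : ℕ) (j : Fin (n + 1))
    (a : (relations p).obj (SimplexCategory.mk (n + 1)))
    (ha : ((relations p).map (SimplexCategory.σ j)).hom a = 0) :
    (relationsProj p (n + 1) j).hom a = a := by
  apply Subtype.ext
  obtain ⟨x, hx⟩ := eq_of_pushforward_predAbove_eq_zero (K := K) j a.1
    ((relations_map_val p (SimplexCategory.σ j) a).symm.trans (congrArg Subtype.val ha))
  rw [relationsProj_val, hx, partialSums_differences_single, Pi.single_eq_same,
    differences_single]

/-- The element `a - s (q a)` lies in the kernel of `q`. This turns the factorisation required by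
`IsPolynomialOfDegreeLE.eq_zero` into a check on kernels. -/
lemma comp_eq_of_forall_ker {M N P : ModuleCat.{u} K} (q : M ⟶ N) (s : N ⟶ M) (hs : s ≫ q = 𝟙 N)
    (t : M ⟶ P) (ht : ∀ a, q.hom a = 0 → t.hom a = 0) : q ≫ s ≫ t = t := by
  apply ModuleCat.hom_ext
  refine LinearMap.ext fun a => ?_
  have h := ht (a - s.hom (q.hom a)) (by
    rw [map_sub, sub_eq_zero]
    exact congr($(hs).hom (q.hom a)).symm)
  rw [map_sub, sub_eq_zero] at h
  exact h.symm

/-- The map `relationsProj i` is the identity on the kernel of `σ i` and zero on the kernels of the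
other codegeneracies. So each of the `d + 1` summands of the identity kills the kernel of every
chosen codegeneracy but its own. -/
lemma IsPolynomialOfDegreeLE.normalized_eq_zero {Φ : ModuleCat.{u} K ⥤ ModuleCat.{u} K} {d m : ℕ}
    (hΦ : IsPolynomialOfDegreeLE Φ d) (hm : d ≤ m)
    (x : Φ.obj ((relations p).obj (SimplexCategory.mk (m + 1))))
    (hx : ∀ i : Fin (m + 1), (Φ.map ((relations p).map (SimplexCategory.σ i))).hom x = 0) :
    x = 0 := by
  let τ (j : Fin d) := relationsProj p (m + 1) (j.castLE (by omega))
  -- The last summand is the complement of the others, not the next `relationsProj`, so that the sum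
  -- is the identity for every `m`. The bound `d ≤ m` provides the `d + 1` codegeneracies.
  refine hΦ.eq_zero (Fin.snoc (α := fun _ => _ ⟶ _) τ (𝟙 _ - ∑ j, τ j)) ?_ _
    (fun j => (relations p).map (SimplexCategory.σ (j.castLE (by omega : d + 1 ≤ m + 1))))
    (fun j => (relations p).map (SimplexCategory.δ (j.castLE (by omega : d + 1 ≤ m + 1)).castSucc))
    (fun i j hij => comp_eq_of_forall_ker _ _ ?_ _ fun a ha => ?_) x fun j => hx _
  · rw [Fin.sum_univ_castSucc]
    simp
  · rw [← Functor.map_comp, SimplexCategory.δ_comp_σ_self, CategoryTheory.Functor.map_id]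
  · refine Fin.lastCases ?_ (fun i hij => ?_) i hij
    · intro hij
      obtain ⟨j, rfl⟩ := Fin.exists_castSucc_eq.2 hij.symm
      rw [Fin.snoc_last, ModuleCat.hom_sub, ModuleCat.hom_sum, LinearMap.sub_apply,
        LinearMap.sum_apply, Finset.sum_eq_single j, show (τ j).hom a = a from relationsProj_eq_self p m _ a ha]
      · simp
      · intro k _ hk
        refine relationsProj_eq_zero p m (fun h => hk ?_) a ha
        simpa [Fin.ext_iff] using h
      · simp
    · rw [Fin.snoc_castSucc]
      refine relationsProj_eq_zero p m (fun h => hij ?_) a ha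
      simpa [Fin.ext_iff] using h

variable (A) in
/-- The presentation of `A` by the free module on its elements. -/
def freePres : Pres A where
  obj := Over.mk (Y := ModuleCat.of K (A →₀ K))
    (ModuleCat.ofHom (Finsupp.linearCombination K (id : A → A)))
  property := ⟨Finsupp.linearCombination_id_surjective K A,
    inferInstanceAs (Module.Free K (A →₀ K))⟩

/-- This is the weak initiality needed for the standard complex; it comes from projectivity of free
modules. -/
lemma nonempty_pres_hom (q : Pres A) : Nonempty (p ⟶ q) := by
  have := p.property.2
  obtain ⟨g, hg⟩ := Module.projective_lifting_property q.obj.hom.hom p.obj.hom.hom q.property.1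
  exact ⟨ObjectProperty.homMk (Over.homMk (ModuleCat.ofHom g) (ModuleCat.hom_ext hg))⟩

theorem isZero_higherLim_relationFunctor (Φ : ModuleCat.{u} K ⥤ ModuleCat.{u} K) (d : ℕ)
    (hΦ : IsPolynomialOfDegreeLE Φ d) (A : ModuleCat.{u} K) (i : ℕ) (hi : d < i) :
    IsZero (higherLim (relationFunctor A ⋙ Φ) i) := by
  obtain ⟨m, rfl⟩ : ∃ m, i = m + 1 := ⟨i - 1, by omega⟩
  refine isZero_higherLim (freePres A) (copowerCofan _) (copowerCofanIsColimit _)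
    (nonempty_pres_hom _) _ m fun x hx => ?_
  simp only [normalizedSubmodule, Submodule.mem_iInf, LinearMap.mem_ker] at hx
  exact hΦ.normalized_eq_zero (freePres A) (Nat.le_of_lt_succ hi) x hx

end Polynomial

/-! ### Extension by zero to integer degrees and the shift by `-1` -/

section ExtendShift

open ComplexShape HomologicalComplex

variable {D : Type w} [Category.{v} D] [Preadditive D] [HasZeroObject D]

lemma isZero_extend_X_of_nonpos (L : CochainComplex D ℕ) (h : IsZero (L.X 0)) (i : ℤ)
    (hi : i ≤ 0) : IsZero ((L.extend embeddingUpNat).X i) := by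
  rcases hi.eq_or_lt with rfl | hi
  · exact h.of_iso (L.extendXIso embeddingUpNat (i := 0) rfl)
  · exact L.isZero_extend_X _ _ fun n (hn : (n : ℤ) = i) => by omega

lemma isZero_extend_X_of_neg (L : CochainComplex D ℕ) (i : ℤ) (hi : i < 0) :
    IsZero ((L.extend embeddingUpNat).X i) :=
  L.isZero_extend_X _ _ fun n (hn : (n : ℤ) = i) => by omega

lemma embeddingUpNat_f_sub_one (n : ℕ) : embeddingUpNat.f n = embeddingUpNat.f (n + 1) + -1 := by
  change (n : ℤ) = ((n + 1 : ℕ) : ℤ) + -1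
  omega

variable {L C : CochainComplex D ℕ} (h : IsZero (L.X 0)) (φ : ∀ n, L.X (n + 1) ≅ C.X n)

/-- The isomorphism `Lⁱ ≅ Cⁱ⁻¹` of the extensions by zero given by `Lⁿ⁺¹ ≅ Cⁿ`. -/
def extendShiftXIso : ∀ i : ℤ,
    (L.extend embeddingUpNat).X i ≅ (C.extend embeddingUpNat).X (i + -1)
  | Int.ofNat 0 => (isZero_extend_X_of_nonpos L h _ le_rfl).iso
      (isZero_extend_X_of_neg C _ (by decide))
  | Int.ofNat (n + 1) => L.extendXIso embeddingUpNat (i := n + 1) rfl ≪≫ φ n ≪≫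
      (C.extendXIso embeddingUpNat (embeddingUpNat_f_sub_one n)).symm
  | Int.negSucc n => (isZero_extend_X_of_neg L _ (Int.negSucc_lt_zero n)).iso
      (isZero_extend_X_of_neg C _ (by omega))

/-- Keeping both degree identifications as hypotheses lets the formula be used at any integer
expression for the degree. -/
lemma extendShiftXIso_eq (i : ℤ) (n : ℕ) (hi : embeddingUpNat.f (n + 1) = i)
    (hi' : embeddingUpNat.f n = i + -1) :
    extendShiftXIso h φ i = L.extendXIso embeddingUpNat hi ≪≫ φ n ≪≫
      (C.extendXIso embeddingUpNat hi').symm := by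
  subst hi
  rfl

lemma exists_embeddingUpNat_f_succ (i : ℤ) (hi : 0 < i) : ∃ n, embeddingUpNat.f (n + 1) = i :=
  ⟨(i - 1).toNat, by
    change (((i - 1).toNat + 1 : ℕ) : ℤ) = i
    omega⟩

/-- In degrees at most zero the source is zero. In positive degrees the shift's sign
`(-1).negOnePow` cancels the sign in `hφ`. -/
lemma extendShiftXIso_comm
    (hφ : ∀ n, L.d (n + 1) (n + 2) ≫ (φ (n + 1)).hom = -((φ n).hom ≫ C.d n (n + 1)))
    (i j : ℤ) (hij : i + 1 = j) :
    (extendShiftXIso h φ i).hom ≫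
        ((-1 : ℤ).negOnePow • (C.extend embeddingUpNat).d (i + -1) (j + -1)) =
      (L.extend embeddingUpNat).d i j ≫ (extendShiftXIso h φ j).hom := by
  rcases le_or_gt i 0 with hi | hi
  · exact (isZero_extend_X_of_nonpos L h i hi).eq_of_src _ _
  · obtain ⟨n, rfl⟩ := exists_embeddingUpNat_f_succ i hi
    have hj : embeddingUpNat.f (n + 2) = j := hij
    have hj' : embeddingUpNat.f (n + 1) = j + -1 := by omega
    rw [extendShiftXIso_eq h φ _ n rfl (embeddingUpNat_f_sub_one n),
      extendShiftXIso_eq h φ _ (n + 1) hj hj',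
      C.extend_d_eq embeddingUpNat (embeddingUpNat_f_sub_one n) hj',
      L.extend_d_eq embeddingUpNat rfl hj]
    simp only [Iso.trans_hom, Iso.symm_hom, Category.assoc, Iso.inv_hom_id_assoc]
    rw [reassoc_of% (hφ n)]
    simp

lemma extendShiftXIso_naturality {L' C' : CochainComplex D ℕ} (h' : IsZero (L'.X 0))
    (φ' : ∀ n, L'.X (n + 1) ≅ C'.X n) (f : L ⟶ L') (g : C ⟶ C')
    (hfg : ∀ n, f.f (n + 1) ≫ (φ' n).hom = (φ n).hom ≫ g.f n) (i : ℤ) :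
    (extendMap f embeddingUpNat).f i ≫ (extendShiftXIso h' φ' i).hom =
      (extendShiftXIso h φ i).hom ≫ (extendMap g embeddingUpNat).f (i + -1) := by
  rcases le_or_gt i 0 with hi | hi
  · exact (isZero_extend_X_of_nonpos L h i hi).eq_of_src _ _
  · obtain ⟨n, rfl⟩ := exists_embeddingUpNat_f_succ i hi
    rw [extendShiftXIso_eq h φ _ n rfl (embeddingUpNat_f_sub_one n),
      extendShiftXIso_eq h' φ' _ n rfl (embeddingUpNat_f_sub_one n),
      extendMap_f f embeddingUpNat rfl, extendMap_f g embeddingUpNat (embeddingUpNat_f_sub_one n)]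
    simp only [Iso.trans_hom, Iso.symm_hom, Category.assoc, Iso.inv_hom_id_assoc]
    rw [reassoc_of% (hfg n)]

/-- Isomorphisms `Lⁿ⁺¹ ≅ Cⁿ` that anticommute with the differentials give an isomorphism
`L ≅ C[-1]` of the extensions by zero, if `L⁰ = 0`. -/
def extendShiftIso
    (hφ : ∀ n, L.d (n + 1) (n + 2) ≫ (φ (n + 1)).hom = -((φ n).hom ≫ C.d n (n + 1))) :
    L.extend embeddingUpNat ≅
      (shiftFunctor (CochainComplex D ℤ) (-1 : ℤ)).obj (C.extend embeddingUpNat) :=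
  HomologicalComplex.Hom.isoOfComponents (extendShiftXIso h φ) (extendShiftXIso_comm h φ hφ)

lemma extendShiftIso_naturality
    (hφ : ∀ n, L.d (n + 1) (n + 2) ≫ (φ (n + 1)).hom = -((φ n).hom ≫ C.d n (n + 1)))
    {L' C' : CochainComplex D ℕ} (h' : IsZero (L'.X 0)) (φ' : ∀ n, L'.X (n + 1) ≅ C'.X n)
    (hφ' : ∀ n, L'.d (n + 1) (n + 2) ≫ (φ' (n + 1)).hom = -((φ' n).hom ≫ C'.d n (n + 1)))
    (f : L ⟶ L') (g : C ⟶ C') (hfg : ∀ n, f.f (n + 1) ≫ (φ' n).hom = (φ n).hom ≫ g.f n) :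
    extendMap f embeddingUpNat ≫ (extendShiftIso h' φ' hφ').hom =
      (extendShiftIso h φ hφ).hom ≫
        (shiftFunctor (CochainComplex D ℤ) (-1 : ℤ)).map (extendMap g embeddingUpNat) := by
  ext i
  exact extendShiftXIso_naturality h φ h' φ' f g hfg i

end ExtendShift

/-! ### Relations of the identity presentation -/

section RelationsIso

variable {K : Type u} [CommRing K] (A : ModuleCat.{u} K) [Module.Free K A]

/-- The isomorphism `Ker (A^{n+1} → A) ≅ Aⁿ` given by the partial sums. -/
def relationsIso (n : ℕ) : (relations (idPres A)).obj (SimplexCategory.mk n) ≅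
    ModuleCat.of K (Fin n → A) where
  hom := ModuleCat.ofHom (partialSums K A n ∘ₗ (relationsSubmodule (idPres A) n).subtype)
  inv := ModuleCat.ofHom ((differences K A n).codRestrict (relationsSubmodule (idPres A) n)
    fun y => by
      have : sumMap (fun _ : Fin (n + 1) => (LinearMap.id : A →ₗ[K] A)) ∘ₗ differences K A n = 0 :=
        LinearMap.pi_ext fun i x => by
          rw [LinearMap.comp_apply, differences_single, map_sub, sumMap_single, sumMap_single,
            sub_self]
          rfl
      exact congr($this y))
  hom_inv_id := by
    apply ModuleCat.hom_ext
    refine LinearMap.ext fun a => Subtype.ext ?_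
    exact differences_partialSums n a.1 ((mem_relationsSubmodule (idPres A) n a.1).1 a.2)
  inv_hom_id := by
    apply ModuleCat.hom_ext
    refine LinearMap.ext fun y => ?_
    exact partialSums_differences n y

lemma relationsIso_val_sum (n : ℕ) (a : (relations (idPres A)).obj (SimplexCategory.mk n)) :
    ∑ j, (a.1 j : A) = 0 :=
  (mem_relationsSubmodule (idPres A) n a.1).1 a.2

end RelationsIso

/-! ### The standard complex at the identity as the complex of cross effects -/

section CrossEffectIso

variable {K : Type u} [CommRing K] (Φ : ModuleCat.{u} K ⥤ ModuleCat.{u} K) (A : ModuleCat.{u} K)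

/-- The map `A^{n+1} → Aⁿ` that deletes the `j`-th entry. -/
def deleteHom (n : ℕ) (j : Fin (n + 1)) :
    ModuleCat.of K (Fin (n + 1) → A) ⟶ ModuleCat.of K (Fin n → A) :=
  ModuleCat.ofHom (LinearMap.funLeft K A j.succAbove)

/-- Reindexing `{i // i ≠ j}` by `Fin n` through `succAbove` gives the projections the form that
codegeneracies take in partial-sum coordinates. -/
lemma mem_crossEffect_iff_deleteHom (n : ℕ) (x : Φ.obj (ModuleCat.of K (Fin (n + 1) → A))) :
    x ∈ crossEffect Φ (fun _ : Fin (n + 1) => A) ↔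
      ∀ j, (Φ.map (deleteHom A n j)).hom x = 0 := by
  rw [mem_crossEffect]
  refine forall_congr' fun j => ⟨fun h => ?_, fun h => ?_⟩
  · have hj : prHom (fun _ : Fin (n + 1) => A) j ≫ ModuleCat.ofHom (LinearMap.funLeft K A
        (finSuccAboveEquiv j)) = deleteHom A n j := rfl
    rw [← hj, Φ.map_comp, ModuleCat.hom_comp, LinearMap.comp_apply, h, map_zero]
  · have hj : deleteHom A n j ≫ ModuleCat.ofHom (LinearMap.funLeft K A
        (finSuccAboveEquiv j).symm) = prHom (fun _ : Fin (n + 1) => A) j := by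
      apply ModuleCat.hom_ext
      refine LinearMap.ext fun a => funext fun k => ?_
      exact congrArg (fun i => a i.1) ((finSuccAboveEquiv j).apply_symm_apply k)
    rw [← hj, Φ.map_comp, ModuleCat.hom_comp, LinearMap.comp_apply, h, map_zero]

/-- A map with zero `j`-th coordinate factors through the embedding of the other summands. This
disposes of the outer cofaces. -/
lemma crossEffectProj_map_eq_zero {n : ℕ} {M : ModuleCat.{u} K}
    (f : M ⟶ ModuleCat.of K (Fin n → A)) (j : Fin n)
    (hf : ∀ a, (f.hom a : Fin n → A) j = 0) (x : Φ.obj M) :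
    crossEffectProj Φ (fun _ : Fin n => A) ((Φ.map f).hom x) = 0 := by
  have h : f ≫ prHom (fun _ : Fin n => A) j ≫ emHom (fun _ : Fin n => A) j = f := by
    apply ModuleCat.hom_ext
    refine LinearMap.ext fun a => funext fun i => ?_
    by_cases hij : i = j
    · subst hij
      simp [prHom, emHom, hf]
    · simp [prHom, emHom, hij]
  rw [← h, ← Category.assoc, Φ.map_comp, ModuleCat.hom_comp, LinearMap.comp_apply,
    crossEffectProj_emHom]

lemma normalizedComplex_d (V : CosimplicialObject (ModuleCat.{u} K)) (n : ℕ) :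
    (normalizedComplex V).d n (n + 1) =
      ModuleCat.ofHom ((alternatingCoface V n).restrict (alternatingCoface_mem V n)) := by
  simp only [normalizedComplex, CochainComplex.of_d]

lemma crossEffectComplex_d (n : ℕ) :
    (crossEffectComplex Φ A).d n (n + 1) = crossEffectD Φ A n := by
  simp only [crossEffectComplex, CochainComplex.of_d]

lemma crossEffectD_apply (n : ℕ) (y : crossEffectTerm Φ A n) : (crossEffectD Φ A n).hom y =
    ∑ i : Fin (n + 1), (-1 : ℤ) ^ (i : ℕ) • crossEffectProj Φ (fun _ : Fin (n + 2) => A)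
      ((Φ.map (diag A i)).hom y.1) := by
  rw [crossEffectD, ModuleCat.hom_sum, LinearMap.sum_apply]
  rfl

variable [Module.Free K A]

lemma relations_σ_relationsIso (n : ℕ) (j : Fin (n + 1)) :
    (relations (idPres A)).map (SimplexCategory.σ j) ≫ (relationsIso A n).hom =
      (relationsIso A (n + 1)).hom ≫ deleteHom A n j := by
  apply ModuleCat.hom_ext
  refine LinearMap.ext fun a => ?_
  exact partialSums_pushforward_predAbove j a.1

lemma relations_δ_relationsIso (n : ℕ) (i : Fin (n + 1)) :
    (relations (idPres A)).map (SimplexCategory.δ i.succ.castSucc) ≫ (relationsIso A (n + 2)).hom =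
      (relationsIso A (n + 1)).hom ≫ diag A i := by
  apply ModuleCat.hom_ext
  refine LinearMap.ext fun a => ?_
  exact partialSums_pushforward_succAbove i a.1

/-- The cosimplicial module `Φ R_A (id^•)`. -/
abbrev relationsCosimplicial : CosimplicialObject (ModuleCat.{u} K) :=
  presCopowers (idPres A) ⋙ relationFunctor A ⋙ Φ

/-- Partial sums turn the codegeneracy `j` into deletion of the `j`-th entry, so the two families of
kernel conditions correspond. -/
lemma map_relationsIso_mem_crossEffect_iff (n : ℕ)
    (x : Φ.obj ((relations (idPres A)).obj (SimplexCategory.mk (n + 1)))) :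
    (Φ.map (relationsIso A (n + 1)).hom).hom x ∈ crossEffect Φ (fun _ : Fin (n + 1) => A) ↔
      x ∈ normalizedSubmodule (relationsCosimplicial Φ A) (n + 1) := by
  rw [mem_crossEffect_iff_deleteHom]
  simp only [normalizedSubmodule, Submodule.mem_iInf, LinearMap.mem_ker]
  refine forall_congr' fun j => ?_
  rw [← LinearMap.comp_apply, ← ModuleCat.hom_comp, ← Φ.map_comp, ← relations_σ_relationsIso,
    Φ.map_comp, ModuleCat.hom_comp, LinearMap.comp_apply]
  have hinj : Function.Injective (Φ.map (relationsIso A n).hom).hom :=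
    (Φ.mapIso (relationsIso A n)).toLinearEquiv.injective
  exact map_eq_zero_iff _ hinj

/-- The isomorphism between the `n + 1`-st term of the standard complex at `id_A` and the cross
effect `Φ(A|⋯|A)` with `n + 1` entries. -/
def normalizedIsoCrossEffect (n : ℕ) :
    ModuleCat.of K (normalizedSubmodule (relationsCosimplicial Φ A) (n + 1)) ≅
      crossEffectTerm Φ A n where
  hom := ModuleCat.ofHom ((Φ.map (relationsIso A (n + 1)).hom).hom.restrict
    fun x hx => (map_relationsIso_mem_crossEffect_iff Φ A n x).2 hx)
  inv := ModuleCat.ofHom (LinearMap.restrict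
    (q := normalizedSubmodule (relationsCosimplicial Φ A) (n + 1))
    (Φ.map (relationsIso A (n + 1)).inv).hom fun x hx => by
      refine (map_relationsIso_mem_crossEffect_iff Φ A n _).1 ?_
      rw [← LinearMap.comp_apply, ← ModuleCat.hom_comp, ← Φ.map_comp, Iso.inv_hom_id, Φ.map_id]
      exact hx)
  hom_inv_id := by
    apply ModuleCat.hom_ext
    refine LinearMap.ext fun x => Subtype.ext ?_
    exact congr($((Φ.mapIso (relationsIso A (n + 1))).hom_inv_id).hom x.1)
  inv_hom_id := by
    apply ModuleCat.hom_ext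
    refine LinearMap.ext fun x => Subtype.ext ?_
    exact congr($((Φ.mapIso (relationsIso A (n + 1))).inv_hom_id).hom x.1)

lemma crossEffectProj_map_δ (n : ℕ)
    (x : Φ.obj ((relations (idPres A)).obj (SimplexCategory.mk (n + 1)))) (k : Fin (n + 3)) :
    crossEffectProj Φ (fun _ : Fin (n + 2) => A) ((Φ.map (relationsIso A (n + 2)).hom).hom
      ((Φ.map ((relations (idPres A)).map (SimplexCategory.δ k))).hom x)) =
    crossEffectProj Φ (fun _ : Fin (n + 2) => A) ((Φ.map
      ((relations (idPres A)).map (SimplexCategory.δ k) ≫ (relationsIso A (n + 2)).hom)).hom x) := by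
  rw [Φ.map_comp]
  rfl

lemma crossEffectProj_alternatingCoface (n : ℕ)
    (x : Φ.obj ((relations (idPres A)).obj (SimplexCategory.mk (n + 1)))) :
    crossEffectProj Φ (fun _ : Fin (n + 2) => A) ((Φ.map (relationsIso A (n + 2)).hom).hom
      (alternatingCoface (relationsCosimplicial Φ A) (n + 1) x)) =
    -∑ i : Fin (n + 1), (-1 : ℤ) ^ (i : ℕ) • crossEffectProj Φ (fun _ : Fin (n + 2) => A)
      ((Φ.map (diag A i)).hom ((Φ.map (relationsIso A (n + 1)).hom).hom x)) := by
  have h : alternatingCoface (relationsCosimplicial Φ A) (n + 1) x =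
    ∑ k : Fin (n + 3), (-1 : ℤ) ^ (k : ℕ) •
      (Φ.map ((relations (idPres A)).map (SimplexCategory.δ k))).hom x :=
    alternatingCoface_apply _ _ _
  rw [h, map_sum, map_sum]
  simp only [map_zsmul, crossEffectProj_map_δ]
  -- This splits off the outer cofaces, which the projection kills. The inner coface `i + 1`
  -- contributes `Δ^i` with sign `(-1)^{i+1}`, hence the overall minus.
  rw [Fin.sum_univ_succ, Fin.sum_univ_castSucc]
  rw [crossEffectProj_map_eq_zero Φ A _ 0 (fun a : (relations (idPres A)).obj (SimplexCategory.mk (n + 1)) =>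
      partialSums_pushforward_zero a.1),
    Fin.succ_last, crossEffectProj_map_eq_zero Φ A _ (Fin.last (n + 1))
      (fun a : (relations (idPres A)).obj (SimplexCategory.mk (n + 1)) =>
        partialSums_pushforward_last a.1 (relationsIso_val_sum A _ a)),
    smul_zero, smul_zero, zero_add, add_zero, ← Finset.sum_neg_distrib]
  refine Finset.sum_congr rfl fun i _ => ?_
  rw [Fin.succ_castSucc, relations_δ_relationsIso, Φ.map_comp]
  simp [pow_succ]

/-- The kernel of the identity is zero, so `Φ(0) = 0` is exactly what makes the degree-zero term
vanish. -/
lemma isZero_LimComplex_X_zero (hΦ : IsZero (Φ.obj (ModuleCat.of K PUnit.{u + 1}))) :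
    IsZero ((LimComplex Φ (idPres A)).X 0) := by
  have e : (relations (idPres A)).obj (SimplexCategory.mk 0) ≅ ModuleCat.of K PUnit.{u + 1} :=
    (IsZero.of_iso (ModuleCat.isZero_of_subsingleton (ModuleCat.of K (Fin 0 → A)))
      (relationsIso A 0)).iso (ModuleCat.isZero_of_subsingleton _)
  have := ModuleCat.subsingleton_of_isZero (hΦ.of_iso (Φ.mapIso e))
  exact ModuleCat.isZero_of_iff_subsingleton.2 (inferInstanceAs (Subsingleton
    (⊤ : Submodule K (Φ.obj ((relations (idPres A)).obj (SimplexCategory.mk 0))))))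

/-- The value already lies in the cross effect, which the projection fixes. Inserting the projection
makes the coboundary formula applicable. -/
lemma normalizedIso_apply (n : ℕ) (x : normalizedSubmodule (relationsCosimplicial Φ A) (n + 1)) :
    (normalizedIsoCrossEffect Φ A n).hom.hom x = crossEffectProj Φ (fun _ : Fin (n + 1) => A)
      ((Φ.map (relationsIso A (n + 1)).hom).hom x.1) :=
  (crossEffectProj_of_mem Φ _ ((normalizedIsoCrossEffect Φ A n).hom.hom x)).symm

lemma alternatingCoface_normalizedIso (n : ℕ) :
    ModuleCat.ofHom ((alternatingCoface (relationsCosimplicial Φ A) (n + 1)).restrict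
        (alternatingCoface_mem (relationsCosimplicial Φ A) (n + 1))) ≫
      (normalizedIsoCrossEffect Φ A (n + 1)).hom =
    -((normalizedIsoCrossEffect Φ A n).hom ≫ crossEffectD Φ A n) := by
  apply ModuleCat.hom_ext
  refine LinearMap.ext fun x => ?_
  have h := crossEffectProj_alternatingCoface Φ A n x.1
  have h1 := normalizedIso_apply Φ A (n + 1)
    ((alternatingCoface (relationsCosimplicial Φ A) (n + 1)).restrict
      (alternatingCoface_mem (relationsCosimplicial Φ A) (n + 1)) x)
  have h2 := crossEffectD_apply Φ A n ((normalizedIsoCrossEffect Φ A n).hom.hom x)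
  exact h1.trans (h.trans (congrArg Neg.neg h2.symm))

lemma LimComplex_d_normalizedIso (n : ℕ) :
    (LimComplex Φ (idPres A)).d (n + 1) (n + 2) ≫ (normalizedIsoCrossEffect Φ A (n + 1)).hom =
      -((normalizedIsoCrossEffect Φ A n).hom ≫ (crossEffectComplex Φ A).d n (n + 1)) := by
  rw [show (LimComplex Φ (idPres A)).d (n + 1) (n + 2) = _ from
    normalizedComplex_d (relationsCosimplicial Φ A) (n + 1), crossEffectComplex_d]
  exact alternatingCoface_normalizedIso Φ A n

/-- Partial sums commute with every linear map applied entrywise; naturality in the functor is that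
of `α`. -/
lemma LimComplexMap_normalizedIso {Φ Ψ : ModuleCat.{u} K ⥤ ModuleCat.{u} K} (α : Φ ⟶ Ψ)
    {A B : ModuleCat.{u} K} [Module.Free K A] [Module.Free K B] (f : A ⟶ B) (n : ℕ) :
    (LimComplexMap α (idPres A) (idPres B) f f rfl).f (n + 1) ≫
        (normalizedIsoCrossEffect Ψ B n).hom =
      (normalizedIsoCrossEffect Φ A n).hom ≫ (crossEffectComplexMap α f).f n := by
  have h : (relationCopowersMap (idPres A) (idPres B) f f rfl).app (SimplexCategory.mk (n + 1)) ≫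
      (relationsIso B (n + 1)).hom = (relationsIso A (n + 1)).hom ≫ powMap f (n + 1) := by
    apply ModuleCat.hom_ext
    refine LinearMap.ext fun a => ?_
    exact partialSums_map f.hom (n + 1) a.1
  have h' : (Φ.map ((relationCopowersMap (idPres A) (idPres B) f f rfl).app
      (SimplexCategory.mk (n + 1))) ≫ α.app _) ≫ Ψ.map (relationsIso B (n + 1)).hom =
      Φ.map (relationsIso A (n + 1)).hom ≫ powApp α f (n + 1) := by
    rw [Category.assoc, ← α.naturality, ← Category.assoc, ← Φ.map_comp, h, Φ.map_comp,
      Category.assoc]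
    rfl
  apply ModuleCat.hom_ext
  refine LinearMap.ext fun x => Subtype.ext ?_
  exact congr($(h').hom x.1)

end CrossEffectIso

end RelLim

end

theorem mainTheorem5 (K : Type u) [CommRing K] :
    (∃ e : ∀ (Φ : ModuleCat.{u} K ⥤ ModuleCat.{u} K)
        (_ : IsZero (Φ.obj (ModuleCat.of K PUnit.{u + 1})))
        (A : ModuleCat.{u} K) [Module.Free K A],
        (RelLim.LimComplex Φ (RelLim.idPres A)).extend ComplexShape.embeddingUpNat ≅
          (shiftFunctor (CochainComplex (ModuleCat.{u} K) ℤ) (-1 : ℤ)).obj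
            ((RelLim.crossEffectComplex Φ A).extend ComplexShape.embeddingUpNat),
      ∀ (Φ Ψ : ModuleCat.{u} K ⥤ ModuleCat.{u} K)
        (hΦ : IsZero (Φ.obj (ModuleCat.of K PUnit.{u + 1})))
        (hΨ : IsZero (Ψ.obj (ModuleCat.of K PUnit.{u + 1})))
        (α : Φ ⟶ Ψ) (A B : ModuleCat.{u} K) [Module.Free K A] [Module.Free K B] (f : A ⟶ B),
        HomologicalComplex.extendMap
            (RelLim.LimComplexMap α (RelLim.idPres A) (RelLim.idPres B) f f rfl)
            ComplexShape.embeddingUpNat ≫ (e Ψ hΨ B).hom =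
          (e Φ hΦ A).hom ≫
            (shiftFunctor (CochainComplex (ModuleCat.{u} K) ℤ) (-1 : ℤ)).map
              (HomologicalComplex.extendMap (RelLim.crossEffectComplexMap α f)
                ComplexShape.embeddingUpNat)) ∧
    (∀ (Φ : ModuleCat.{u} K ⥤ ModuleCat.{u} K) (d : ℕ), RelLim.IsPolynomialOfDegreeLE Φ d →
      ∀ (A : ModuleCat.{u} K) (i : ℕ), d < i →
        IsZero (RelLim.higherLim (RelLim.relationFunctor A ⋙ Φ) i)) := by
  refine ⟨⟨fun Φ hΦ A _ => RelLim.extendShiftIso (RelLim.isZero_LimComplex_X_zero Φ A hΦ)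
    (RelLim.normalizedIsoCrossEffect Φ A) (RelLim.LimComplex_d_normalizedIso Φ A), ?_⟩,
    RelLim.isZero_higherLim_relationFunctor⟩
  intro Φ Ψ hΦ hΨ α A B _ _ f
  exact RelLim.extendShiftIso_naturality _ _ _ _ _ _ _ _
    (RelLim.LimComplexMap_normalizedIso α f)
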